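/- Let $R$ be a principal ideal domain, let $G$ be an $R$-module, and let $0\to G\xrightarrow{\alpha}G'\xrightarrow{\beta}G''\to 0$ be an injective resolution of $G$. For a ($\mathbb Z$-graded) cochain complex $C^*$ of $R$-modules, let $\bar H_n(C^*;G)$ be the $n$-th homology of the chain complex $C_n(\beta_\#)=\operatorname{Hom}_R(C^n,G')\oplus\operatorname{Hom}_R(C^{n+1},G'')$ with boundary $\partial(\varphi',\varphi'')=(\varphi'\circ\delta,\ \beta\circ\varphi'-\varphi''\circ\delta)$; it is a contravariant functor of $C^*$. For $i\ge 0$, let $\varprojlim^{(i)}$ denote the $i$-th right derived functor of the inverse limit functor on inverse systems of $R$-modules over a given index set. Theorem 4. Let $\Gamma$ be a (non-empty) directed set. For every direct system $\{C^*_\gamma\}_{\gamma\in\Gamma}$ of cochain complexes of $R$-modules write $\bar H_m^\gamma=\bar H_m(C^*_\gamma;G)$. Then, for every $n\in\mathbb Z$, there is a long exact sequence, infinite in both directions, $$\cdots\to\varprojlim{}^{(2k+1)}\bar H^\gamma_{n+k+1}\to\cdots\to\varprojlim{}^{(3)}\bar H^\gamma_{n+2}\to\varprojlim{}^{(1)}\bar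 H^\gamma_{n+1}\to\bar H_n\bigl(\varinjlim C^*_\gamma;G\bigr)\xrightarrow{\ \pi\ }\varprojlim\bar H^\gamma_n\to\varprojlim{}^{(2)}\bar H^\gamma_{n+1}\to\varprojlim{}^{(4)}\bar H^\gamma_{n+2}\to\cdots\to\varprojlim{}^{(2k)}\bar H^\gamma_{n+k}\to\cdots,$$ in which $\pi$ is the map induced by the canonical cochain maps $C^*_\gamma\to\varinjlim C^*_\gamma$, and all of whose maps are natural in the direct system $\{C^*_\gamma\}_{\gamma\in\Gamma}$. -/

import Mathlib

open CategoryTheory Limits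

universe u

namespace ConeHomology

section Cone

variable {R : Type u} [CommRing R] {G' G'' : ModuleCat.{u} R}

/-- The boundary `∂ (φ', φ'') = (φ' ∘ δ, β ∘ φ' - φ'' ∘ δ)` from degree `n + 1` to degree `n`. -/
def coneBoundary (β : G' ⟶ G'') (C : CochainComplex (ModuleCat.{u} R) ℤ) (n : ℤ) :
    ((C.X (n + 1) →ₗ[R] G') × (C.X (n + 1 + 1) →ₗ[R] G'')) →ₗ[R]
      ((C.X n →ₗ[R] G') × (C.X (n + 1) →ₗ[R] G'')) where
  toFun φ := (φ.1 ∘ₗ (C.d n (n + 1)).hom,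
    β.hom ∘ₗ φ.1 - φ.2 ∘ₗ (C.d (n + 1) (n + 1 + 1)).hom)
  map_add' φ ψ := by
    ext x
    · simp
    · simp
      abel
  map_smul' r φ := by
    ext x
    · simp
    · simp [smul_sub]

/-- The cone `C_*(β_#)`: in degree `n` it is `Hom(C^n, G') × Hom(C^{n+1}, G'')`. -/
noncomputable def cone (β : G' ⟶ G'') (C : CochainComplex (ModuleCat.{u} R) ℤ) :
    ChainComplex (ModuleCat.{u} R) ℤ :=
  ChainComplex.of
    (fun n => ModuleCat.of R ((C.X n →ₗ[R] G') × (C.X (n + 1) →ₗ[R] G'')))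
    (fun n => ModuleCat.ofHom (coneBoundary β C n))
    (fun n => by
      have h : ∀ (i j k : ℤ) (x : C.X i), (C.d j k).hom ((C.d i j).hom x) = 0 := by
        intro i j k x
        rw [← LinearMap.comp_apply, ← ModuleCat.hom_comp, C.d_comp_d]
        rfl
      apply ModuleCat.hom_ext
      apply LinearMap.ext
      intro φ
      apply Prod.ext
      · apply LinearMap.ext
        intro x
        change φ.1 _ = 0
        rw [h, map_zero]
      · apply LinearMap.ext
        intro x
        change β.hom (φ.1 _) - (β.hom (φ.1 _) - φ.2 _) = 0
        rw [h, map_zero]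
        simp)

theorem cone_d (β : G' ⟶ G'') (C : CochainComplex (ModuleCat.{u} R) ℤ) (n : ℤ) :
    (cone β C).d (n + 1) n = ModuleCat.ofHom (coneBoundary β C n) :=
  ChainComplex.of_d (fun n => ModuleCat.of R ((C.X n →ₗ[R] G') × (C.X (n + 1) →ₗ[R] G'')))
    (fun n => ModuleCat.ofHom (coneBoundary β C n)) n

/-- The map `(φ', φ'') ↦ (φ' ∘ f, φ'' ∘ f)` induced by a cochain map `f` in degree `n`. -/
def coneMapDeg (G' G'' : ModuleCat.{u} R) {C D : CochainComplex (ModuleCat.{u} R) ℤ} (f : C ⟶ D)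
    (n : ℤ) :
    ((D.X n →ₗ[R] G') × (D.X (n + 1) →ₗ[R] G'')) →ₗ[R]
      ((C.X n →ₗ[R] G') × (C.X (n + 1) →ₗ[R] G'')) where
  toFun φ := (φ.1 ∘ₗ (f.f n).hom, φ.2 ∘ₗ (f.f (n + 1)).hom)
  map_add' φ ψ := by ext x <;> simp
  map_smul' r φ := by ext x <;> simp

/-- The chain map `D_*(β_#) ⟶ C_*(β_#)` induced by a cochain map `f : C ⟶ D`. -/
noncomputable def coneMap (β : G' ⟶ G'') {C D : CochainComplex (ModuleCat.{u} R) ℤ} (f : C ⟶ D) :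
    cone β D ⟶ cone β C :=
  ChainComplex.ofHom (fun n => ModuleCat.ofHom (coneMapDeg G' G'' f n))
    (fun n => by
      have h : ∀ (i j : ℤ) (x : C.X i),
          (D.d i j).hom ((f.f i).hom x) = (f.f j).hom ((C.d i j).hom x) := by
        intro i j x
        rw [← LinearMap.comp_apply, ← ModuleCat.hom_comp, f.comm]
        rfl
      rw [cone_d, cone_d]
      apply ModuleCat.hom_ext
      apply LinearMap.ext
      intro φ
      apply Prod.ext
      · apply LinearMap.ext
        intro x
        exact congrArg φ.1 (h _ _ x).symm
      · apply LinearMap.ext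
        intro x
        exact congrArg (fun y => β.hom (φ.1 ((f.f _).hom x)) - φ.2 y) (h _ _ x).symm)

/-- The cone as a contravariant functor of the cochain complex. -/
noncomputable def coneFunctor (β : G' ⟶ G'') :
    (CochainComplex (ModuleCat.{u} R) ℤ)ᵒᵖ ⥤ ChainComplex (ModuleCat.{u} R) ℤ where
  obj C := cone β C.unop
  map f := coneMap β f.unop
  map_id C := by
    ext n φ
    rfl
  map_comp f g := by
    ext n φ
    rfl

/-- `H̄_n(C^*; G) = H_n(C_*(β_#))`, as a contravariant functor of the cochain complex. -/
noncomputable def barHomology (β : G' ⟶ G'') (n : ℤ) :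
    (CochainComplex (ModuleCat.{u} R) ℤ)ᵒᵖ ⥤ ModuleCat.{u} R :=
  coneFunctor β ⋙ HomologicalComplex.homologyFunctor (ModuleCat.{u} R) (ComplexShape.down ℤ) n

end Cone

section DerivedLimits

variable (Γ : Type u) [Preorder Γ] (R : Type u) [CommRing R]

instance enoughInjectives_invSystem : EnoughInjectives (Γᵒᵖ ⥤ ModuleCat.{u} R) :=
  have : IsGrothendieckAbelian.{u} (Γᵒᵖ ⥤ ModuleCat.{u} R) :=
    IsGrothendieckAbelian.of_equivalence (sheafBotEquivalence (C := Γ) (ModuleCat.{u} R))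
  inferInstance

instance additive_lim : (lim : (Γᵒᵖ ⥤ ModuleCat.{u} R) ⥤ ModuleCat.{u} R).Additive where
  map_add {X Y f g} := by
    apply limit.hom_ext
    intro j
    simp

/-- The derived inverse limit `lim^(i)`: the `i`-th right derived functor of the inverse limit
functor on the inverse systems of `R`-modules over `Γ`. -/
noncomputable def derivedLim (i : ℕ) : (Γᵒᵖ ⥤ ModuleCat.{u} R) ⥤ ModuleCat.{u} R :=
  (lim : (Γᵒᵖ ⥤ ModuleCat.{u} R) ⥤ ModuleCat.{u} R).rightDerived i

end DerivedLimits

section Terms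

variable (Γ : Type u) [Preorder Γ] {R : Type u} [CommRing R] {G' G'' : ModuleCat.{u} R}

/-- The inverse system `γ ↦ H̄_n(C^*_γ; G)`, functorially in the direct system `{C^*_γ}`. -/
noncomputable def barSystem (β : G' ⟶ G'') (n : ℤ) :
    (Γ ⥤ CochainComplex (ModuleCat.{u} R) ℤ)ᵒᵖ ⥤ (Γᵒᵖ ⥤ ModuleCat.{u} R) :=
  Functor.opHom Γ (CochainComplex (ModuleCat.{u} R) ℤ) ⋙
    (Functor.whiskeringRight _ _ _).obj (barHomology β n)

/-- `H̄_n(lim→ C^*_γ; G)`, functorially in the direct system `{C^*_γ}`. -/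
noncomputable def barColim (β : G' ⟶ G'') (n : ℤ) :
    (Γ ⥤ CochainComplex (ModuleCat.{u} R) ℤ)ᵒᵖ ⥤ ModuleCat.{u} R :=
  (colim : (Γ ⥤ CochainComplex (ModuleCat.{u} R) ℤ) ⥤ _).op ⋙ barHomology β n

/-- `lim← H̄_n(C^*_γ; G)`, functorially in the direct system `{C^*_γ}`. -/
noncomputable def barLim (β : G' ⟶ G'') (n : ℤ) :
    (Γ ⥤ CochainComplex (ModuleCat.{u} R) ℤ)ᵒᵖ ⥤ ModuleCat.{u} R :=
  barSystem Γ β n ⋙ lim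

/-- `lim^(i) H̄_n(C^*_γ; G)`, functorially in the direct system `{C^*_γ}`. -/
noncomputable def barDerivedLim (β : G' ⟶ G'') (i : ℕ) (n : ℤ) :
    (Γ ⥤ CochainComplex (ModuleCat.{u} R) ℤ)ᵒᵖ ⥤ ModuleCat.{u} R :=
  barSystem Γ β n ⋙ derivedLim Γ R i

/-- The `k`-th term to the left of `H̄_n(lim→ C^*_γ; G)`: `lim^(2k+1) H̄_{n+k+1}^γ`. -/
noncomputable abbrev oddTerm (β : G' ⟶ G'') (n : ℤ) (k : ℕ) :
    (Γ ⥤ CochainComplex (ModuleCat.{u} R) ℤ)ᵒᵖ ⥤ ModuleCat.{u} R :=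
  barDerivedLim Γ β (2 * k + 1) (n + k + 1)

/-- The `k`-th term to the right of `lim← H̄_n^γ`: `lim^(2k+2) H̄_{n+k+1}^γ`. -/
noncomputable abbrev evenTerm (β : G' ⟶ G'') (n : ℤ) (k : ℕ) :
    (Γ ⥤ CochainComplex (ModuleCat.{u} R) ℤ)ᵒᵖ ⥤ ModuleCat.{u} R :=
  barDerivedLim Γ β (2 * k + 2) (n + k + 1)

/-- The cone over `γ ↦ H̄_n(C^*_γ; G)` with vertex `H̄_n(lim→ C^*_γ; G)`, whose legs are induced by
the canonical cochain maps `C^*_γ ⟶ lim→ C^*_γ`. -/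
noncomputable def canonicalCone (β : G' ⟶ G'') (n : ℤ)
    (C : (Γ ⥤ CochainComplex (ModuleCat.{u} R) ℤ)ᵒᵖ) : Cone ((barSystem Γ β n).obj C) where
  pt := (barColim Γ β n).obj C
  π :=
    { app := fun γ => (barHomology β n).map (colimit.ι C.unop γ.unop).op
      naturality := fun γ γ' f => by
        change 𝟙 _ ≫ (barHomology β n).map (colimit.ι C.unop γ'.unop).op =
          (barHomology β n).map (colimit.ι C.unop γ.unop).op ≫
            (barHomology β n).map (C.unop.map f.unop).op
        rw [Category.id_comp, ← Functor.map_comp, ← op_comp, colimit.w] }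

/-- The canonical map `H̄_n(lim→ C^*_γ; G) ⟶ lim← H̄_n(C^*_γ; G)`. -/
noncomputable def canonicalMap (β : G' ⟶ G'') (n : ℤ) : barColim Γ β n ⟶ barLim Γ β n where
  app C := limit.lift ((barSystem Γ β n).obj C) (canonicalCone Γ β n C)
  naturality C C' f := by
    apply limit.hom_ext
    intro γ
    have h : (barHomology β n).map (colim.map f.unop).op ≫
        (barHomology β n).map (colimit.ι C'.unop γ.unop).op =
      (barHomology β n).map (colimit.ι C.unop γ.unop).op ≫
        (barHomology β n).map (f.unop.app γ.unop).op := by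
      rw [← Functor.map_comp, ← Functor.map_comp, ← op_comp, ← op_comp]
      simp
    have h₁ := limit.lift_π (canonicalCone Γ β n C') γ
    have h₂ := limit.lift_π (canonicalCone Γ β n C) γ
    have h₃ := limMap_π ((barSystem Γ β n).map f) γ
    refine (Category.assoc _ _ _).trans ((congrArg (fun x => _ ≫ x) h₁).trans (h.trans ?_))
    refine Eq.trans ?_ (Category.assoc _ _ _).symm
    refine Eq.trans ?_ (congrArg (fun x => _ ≫ x) h₃).symm
    refine Eq.trans ?_ (Category.assoc _ _ _)
    exact (congrArg (fun x => x ≫ ((barSystem Γ β n).map f).app γ) h₂).symm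

end Terms

end ConeHomology

/-! Write K_n, Z_n, B_n, H_n for the chains, cycles, boundaries and homology of the cone, all
regarded as contravariant functors of the cochain complex. The inverse systems γ ↦ Hom(A_γ, I), with
I injective, have no higher derived limits over a directed set (`ext_homSystem_eq_zero`). Hence K_n
is acyclic for the limit. So is the subfunctor L_n of Z_n consisting of the cycles whose first
component vanishes on cocycles, because it is an extension of two functors of the form Hom(-, I).

The decisive point is that B_n ⊆ L_n ⊆ Z_n. The projection Z_n → Z_n/L_n factors through H_n, and it
induces isomorphisms on all higher derived limits because L_n is acyclic. So lim^(i) Z_n → lim^(i)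
H_n has a natural retraction for i ≥ 1 (`exists_retraction`). The long exact sequence of B_n → Z_n →
H_n therefore breaks into pieces, and the sequence Z_{n+1} → K_{n+1} → B_n identifies lim^(i+1) B_n
with lim^(i+2) Z_{n+1} for i ≥ 0. The result is exactness of lim^(i) Z_n → lim^(i) H_n → lim^(i+2)
Z_{n+1} → 0, naturally split on the left when i ≥ 1 (`exists_differential`, `exists_section`).

In degree zero, Z_n turns direct limits into inverse limits. Hence the canonical map has the same
image as lim Z_n → lim H_n (`range_canonicalMap`), and its kernel is lim^(1) Z_{n+1}
(`exists_fromCycles`). To the right of the limit, the maps of the sequence are the quotient map to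
lim^(i+2) Z_{n+1} followed by its inclusion in lim^(i+2) H_{n+1}. To the left they are the
retraction onto lim^(i+2) Z_{n+1} followed by the complementary inclusion in lim^(i) H_n. -/

namespace CategoryTheory

open Abelian

/-! ### Higher right derived functors of Hom(X, -) as Ext, with their module structure -/

section LinearExt

universe v'

variable (R : Type u) [CommRing R] {C : Type v'} [Category.{u} C] [Abelian C] [Linear R C]

/-- The complex `Hom(X, I)` of an injective resolution `I`. -/
noncomputable abbrev InjectiveResolution.homComplex (X : C) {Y : C} (I : InjectiveResolution Y) :
    CochainComplex (ModuleCat.{u} R) ℕ :=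
  (((linearCoyoneda R C).obj (Opposite.op X)).mapHomologicalComplex _).obj I.cocomplex

/-- The morphism underlying a cocycle of `Hom(X, I)`. -/
noncomputable def InjectiveResolution.cyclesHom {X Y : C} (I : InjectiveResolution Y) (n : ℕ) :
    (I.homComplex R X).cycles n →ₗ[R] (X ⟶ I.cocomplex.X n) :=
  ((I.homComplex R X).iCycles n).hom

variable {R} in
lemma InjectiveResolution.cyclesHom_comp_d {X Y : C} (I : InjectiveResolution Y) (n : ℕ)
    (z : (I.homComplex R X).cycles n) :
    I.cyclesHom R n z ≫ I.cocomplex.d n (n + 1) = 0 :=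
  congrArg (fun f => f.hom z) ((I.homComplex R X).iCycles_d n (n + 1))

variable [HasExt.{u} C]

variable {R} in
-- Scaling a class amounts to precomposing it with `r • 𝟙 X`, and precomposition is already known on
-- representatives.
lemma InjectiveResolution.smul_extMk {X Y : C} (I : InjectiveResolution Y) (r : R) {n : ℕ}
    (f : X ⟶ I.cocomplex.X n) (m : ℕ) (hm : n + 1 = m) (hf : f ≫ I.cocomplex.d n m = 0) :
    r • I.extMk f m hm hf = I.extMk (r • f) m hm (by simp [hf]) := by
  have h := I.mk₀_comp_extMk f m hm hf (r • 𝟙 X)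
  rw [Ext.mk₀_smul, Ext.smul_comp, Ext.mk₀_id_comp] at h
  rw [h]
  congr 1
  simp

/-- The functor `Ext X - n` to `R`-modules. -/
noncomputable def extFunctorLinear (X : C) (n : ℕ) : C ⥤ ModuleCat.{u} R where
  obj Y := ModuleCat.of R (Ext X Y n)
  map f := ModuleCat.ofHom ((Ext.mk₀ f).postcompOfLinear R X (add_zero n))
  map_id Y := by ext x; simp
  map_comp f g := by ext x; simp [← Ext.mk₀_comp_mk₀]

/-- The class in `Ext` of a cocycle. -/
noncomputable def InjectiveResolution.cyclesToExt (X : C) {Y : C} (I : InjectiveResolution Y)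
    (n : ℕ) :
    (I.homComplex R X).cycles n ⟶ (extFunctorLinear R X n).obj Y :=
  ModuleCat.ofHom (X := (I.homComplex R X).cycles n) (Y := Ext X Y n)
    { toFun z := I.extMk (I.cyclesHom R n z) (n + 1) rfl (I.cyclesHom_comp_d n z)
      map_add' x y := by
        rw [I.add_extMk]
        congr 1
        exact map_add (I.cyclesHom R n) x y
      map_smul' r x := by
        refine Eq.trans ?_ (I.smul_extMk _ _ _ _ _).symm
        congr 1
        exact map_smul (I.cyclesHom R n) r x }

lemma InjectiveResolution.cyclesToExt_apply {X Y : C} (I : InjectiveResolution Y) (n : ℕ)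
    (z : (I.homComplex R X).cycles n) : (I.cyclesToExt R X n).hom z =
      I.extMk (I.cyclesHom R n z) (n + 1) rfl (I.cyclesHom_comp_d n z) := rfl

lemma InjectiveResolution.toCycles_cyclesToExt (X : C) {Y : C} (I : InjectiveResolution Y)
    (m n : ℕ) :
    (I.homComplex R X).toCycles m n ≫ I.cyclesToExt R X n = 0 := by
  by_cases h : m + 1 = n
  · ext z
    refine (I.extMk_eq_zero_iff _ (n + 1) rfl (I.cyclesHom_comp_d n _) m h).2 ⟨z, ?_⟩
    exact (congrArg (fun f => f.hom z) ((I.homComplex R X).toCycles_i m n)).symm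
  · rw [(I.homComplex R X).toCycles_eq_zero (by simpa using h), zero_comp]

/-- The class in `Ext` of a cohomology class of `Hom(X, I)`. -/
noncomputable def InjectiveResolution.homologyToExt (X : C) {Y : C} (I : InjectiveResolution Y)
    (n : ℕ) :
    (I.homComplex R X).homology n ⟶ (extFunctorLinear R X n).obj Y :=
  ((I.homComplex R X).homologyIsCokernel _ n rfl).desc
    (CokernelCofork.ofπ (I.cyclesToExt R X n) (I.toCycles_cyclesToExt R X _ n))

lemma InjectiveResolution.homologyπ_homologyToExt (X : C) {Y : C} (I : InjectiveResolution Y)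
    (n : ℕ) :
    (I.homComplex R X).homologyπ n ≫ I.homologyToExt R X n = I.cyclesToExt R X n :=
  ((I.homComplex R X).homologyIsCokernel _ n rfl).fac _ WalkingParallelPair.one

variable {R} in
lemma _root_.HomologicalComplex.homologyπ_surjective {ι : Type*} {c : ComplexShape ι}
    (K : HomologicalComplex (ModuleCat.{u} R) c) (n : ι) :
    Function.Surjective (K.homologyπ n).hom :=
  (ModuleCat.epi_iff_surjective _).1 inferInstance

variable {R} in
lemma _root_.HomologicalComplex.exists_iCycles_eq {ι : Type*} {c : ComplexShape ι}
    (K : HomologicalComplex (ModuleCat.{u} R) c) (i j : ι) (hij : c.next i = j)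
    (x : K.X i) (hx : (K.d i j).hom x = 0) : ∃ z : K.cycles i, (K.iCycles i).hom z = x :=
  ((ShortComplex.ShortExact.moduleCat_exact_iff_function_exact
    (ShortComplex.mk _ _ (K.iCycles_d i j))).1
    (ShortComplex.exact_of_f_is_kernel _ (K.cyclesIsKernel i j hij)) x).1 hx

/-- Every class of Ext is represented by a cocycle of Hom(X, I), and it is zero exactly when the
cocycle is a coboundary. The second criterion refers to the preceding degree, hence the restriction
to successors; degree zero is handled by `linearCoyonedaIsoExt`. -/
instance InjectiveResolution.isIso_homologyToExt_succ (X : C) {Y : C} (I : InjectiveResolution Y)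
    (n : ℕ) : IsIso (I.homologyToExt R X (n + 1)) := by
  rw [ConcreteCategory.isIso_iff_bijective]
  have fac : ∀ z, (I.homologyToExt R X (n + 1)).hom
      (((I.homComplex R X).homologyπ (n + 1)).hom z) = (I.cyclesToExt R X (n + 1)).hom z :=
    fun z => congrArg (fun f => f.hom z) (I.homologyπ_homologyToExt R X (n + 1))
  constructor
  · refine (injective_iff_map_eq_zero (I.homologyToExt R X (n + 1)).hom).2 fun x hx => ?_
    obtain ⟨z, rfl⟩ := HomologicalComplex.homologyπ_surjective _ (n + 1) x
    have hz := (fac z).symm.trans hx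
    rw [I.cyclesToExt_apply R] at hz
    have inj : Function.Injective ((I.homComplex R X).iCycles (n + 1)).hom :=
      (ModuleCat.mono_iff_injective _).1 inferInstance
    obtain ⟨g, hg⟩ :=
      (I.extMk_eq_zero_iff _ (n + 1 + 1) rfl (I.cyclesHom_comp_d (n + 1) z) n rfl).1 hz
    have h : ((I.homComplex R X).toCycles n (n + 1)).hom g = z := inj
      ((congrArg (fun f => f.hom g) ((I.homComplex R X).toCycles_i n (n + 1))).trans hg)
    rw [← h]
    exact congrArg (fun f => f.hom g) ((I.homComplex R X).toCycles_comp_homologyπ n (n + 1))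
  · intro y
    obtain ⟨f, hf, rfl⟩ := I.extMk_surjective (X := X) y (n + 1 + 1) rfl
    obtain ⟨z, hz⟩ := (I.homComplex R X).exists_iCycles_eq (n + 1) (n + 1 + 1) (by simp) f hf
    refine ⟨((I.homComplex R X).homologyπ (n + 1)).hom z, (fac z).trans ?_⟩
    rw [I.cyclesToExt_apply R]
    congr 1

lemma InjectiveResolution.homologyToExt_naturality (X : C) {Y Y' : C} (I : InjectiveResolution Y)
    (I' : InjectiveResolution Y') {f : Y ⟶ Y'} (φ : I.Hom I' f) (n : ℕ) :
    HomologicalComplex.homologyMap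
        ((((linearCoyoneda R C).obj (Opposite.op X)).mapHomologicalComplex _).map φ.hom) n ≫
      I'.homologyToExt R X n = I.homologyToExt R X n ≫ (extFunctorLinear R X n).map f := by
  rw [← cancel_epi ((I.homComplex R X).homologyπ n),
    HomologicalComplex.homologyπ_naturality_assoc, ← Category.assoc _ (I.homologyToExt R X n) _,
    I.homologyπ_homologyToExt R]
  refine (congrArg (fun g => _ ≫ g) (I'.homologyπ_homologyToExt R X n)).trans ?_
  ext z
  refine Eq.trans ?_ (InjectiveResolution.extMk_comp_mk₀ (I.cyclesHom R n z) (n + 1) rfl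
    (I.cyclesHom_comp_d n z) φ).symm
  refine (I'.cyclesToExt_apply R n _).trans ?_
  congr 1
  exact congrArg (fun f => f.hom z) (HomologicalComplex.cyclesMap_i
    ((((linearCoyoneda R C).obj (Opposite.op X)).mapHomologicalComplex _).map φ.hom) n)

/-- The higher right derived functors of `Hom(X, -)` are the functors `Ext X -`. -/
noncomputable def rightDerivedLinearCoyonedaIso [EnoughInjectives C] (X : C) (n : ℕ) :
    ((linearCoyoneda R C).obj (Opposite.op X)).rightDerived (n + 1) ≅
      extFunctorLinear R X (n + 1) :=
  NatIso.ofComponents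
    (fun Y => (injectiveResolution Y).isoRightDerivedObj _ (n + 1) ≪≫
      @asIso _ _ _ _ ((injectiveResolution Y).homologyToExt R X (n + 1))
        ((injectiveResolution Y).isIso_homologyToExt_succ R X n))
    (fun {Y Y'} f => by
      let φ : InjectiveResolution.Hom (injectiveResolution Y) (injectiveResolution Y') f :=
        { hom := InjectiveResolution.desc f _ _
          ι_f_zero_comp_hom_f_zero := by
            rw [← HomologicalComplex.comp_f, InjectiveResolution.desc_commutes,
              HomologicalComplex.comp_f] }
      have h : (injectiveResolution Y).ι.f 0 ≫ φ.hom.f 0 = f ≫ (injectiveResolution Y').ι.f 0 := by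
        rw [φ.ι_f_zero_comp_hom_f_zero, CochainComplex.single₀_map_f_zero]
        rfl
      have h₁ := InjectiveResolution.isoRightDerivedObj_hom_naturality f _ _ φ.hom h
        ((linearCoyoneda R C).obj (Opposite.op X)) (n + 1)
      have h₂ := InjectiveResolution.homologyToExt_naturality R X _ _ φ (n + 1)
      rw [Iso.trans_hom, Iso.trans_hom, ← Category.assoc, h₁, Category.assoc, Category.assoc]
      exact congrArg (fun g => _ ≫ g) h₂)

/-- `Ext X - 0` is `Hom(X, -)`. -/
noncomputable def linearCoyonedaIsoExt (X : C) :
    (linearCoyoneda R C).obj (Opposite.op X) ≅ extFunctorLinear R X 0 :=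
  NatIso.ofComponents (fun Y => (Ext.linearEquiv₀ (R := R) (X := X) (Y := Y)).symm.toModuleIso)
    (fun {Y Y'} f => by
      ext g
      exact (Ext.mk₀_comp_mk₀ (X := X) g f).symm)

end LinearExt

end CategoryTheory

namespace CategoryTheory

open Abelian

/-! ### Natural long exact sequences and the Ext functors -/

section DeltaFunctor

universe v'

/-- A cohomological δ-functor with values in modules. -/
structure DeltaFunctor {R : Type u} [CommRing R] {C : Type v'} [Category.{u} C] [Abelian C]
    (T : ℕ → C ⥤ ModuleCat.{u} R) where
  /-- the connecting homomorphism -/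
  δ {S : ShortComplex C} (hS : S.ShortExact) (i : ℕ) : (T i).obj S.X₃ ⟶ (T (i + 1)).obj S.X₁
  δ_naturality {S S' : ShortComplex C} (hS : S.ShortExact) (hS' : S'.ShortExact) (f : S ⟶ S')
    (i : ℕ) : (T i).map f.τ₃ ≫ δ hS' i = δ hS i ≫ (T (i + 1)).map f.τ₁
  exact₁ {S : ShortComplex C} (hS : S.ShortExact) (i : ℕ) :
    Function.Exact (δ hS i) ((T (i + 1)).map S.f)
  exact₂ {S : ShortComplex C} (hS : S.ShortExact) (i : ℕ) :
    Function.Exact ((T i).map S.f) ((T i).map S.g)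
  exact₃ {S : ShortComplex C} (hS : S.ShortExact) (i : ℕ) :
    Function.Exact ((T i).map S.g) (δ hS i)

/-- Isomorphic functors have isomorphic right derived functors. -/
noncomputable def rightDerivedIso {C D : Type*} [Category* C] [Category* D] [Abelian C]
    [Abelian D] [HasInjectiveResolutions C] {F G : C ⥤ D} [F.Additive] [G.Additive] (e : F ≅ G)
    (i : ℕ) : F.rightDerived i ≅ G.rightDerived i where
  hom := NatTrans.rightDerived e.hom i
  inv := NatTrans.rightDerived e.inv i
  hom_inv_id := by rw [← NatTrans.rightDerived_comp, e.hom_inv_id, NatTrans.rightDerived_id]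
  inv_hom_id := by rw [← NatTrans.rightDerived_comp, e.inv_hom_id, NatTrans.rightDerived_id]

lemma exact_of_isos {R : Type u} [CommRing R] {X Y Z X' Y' Z' : ModuleCat.{u} R}
    {f : X ⟶ Y} {g : Y ⟶ Z} {f' : X' ⟶ Y'} {g' : Y' ⟶ Z'} (a : X ≅ X') (b : Y ≅ Y')
    (c : Z ≅ Z') (h₁ : f ≫ b.hom = a.hom ≫ f') (h₂ : g ≫ c.hom = b.hom ≫ g')
    (h : Function.Exact f' g') : Function.Exact f g :=
  (Function.Exact.iff_of_ladder_linearEquiv (f₁₂ := f.hom) (f₂₃ := g.hom) (g₁₂ := f'.hom)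
    (g₂₃ := g'.hom) (e₁ := a.toLinearEquiv) (e₂ := b.toLinearEquiv) (e₃ := c.toLinearEquiv)
    (by ext x; exact congrArg (fun k => k.hom x) h₁.symm)
    (by ext x; exact congrArg (fun k => k.hom x) h₂.symm)).1 h

variable {R : Type u} [CommRing R] {C : Type v'} [Category.{u} C] [Abelian C]

/-- Transport of a δ-functor along isomorphisms. -/
noncomputable def DeltaFunctor.ofIso {T T' : ℕ → C ⥤ ModuleCat.{u} R} (D : DeltaFunctor T')
    (e : ∀ i, T i ≅ T' i) : DeltaFunctor T where
  δ {S} hS i := (e i).hom.app S.X₃ ≫ D.δ hS i ≫ (e (i + 1)).inv.app S.X₁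
  δ_naturality hS hS' f i := by
    have := D.δ_naturality hS hS' f i
    simp only [Category.assoc, NatTrans.naturality_assoc, ← NatTrans.naturality]
    rw [reassoc_of% this]
  exact₁ {S} hS i := exact_of_isos ((e i).app _) ((e (i + 1)).app _) ((e (i + 1)).app _)
    (by simp) (by simp) (D.exact₁ hS i)
  exact₂ {S} hS i := exact_of_isos ((e i).app _) ((e i).app _) ((e i).app _)
    (by simp) (by simp) (D.exact₂ hS i)
  exact₃ {S} hS i := exact_of_isos ((e i).app _) ((e i).app _) ((e (i + 1)).app _)
    (by simp) (by simp) (D.exact₃ hS i)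

/-- The δ-functor `Ext X -`. -/
noncomputable def extDeltaFunctor (R : Type u) [CommRing R] [Linear R C] [HasExt.{u} C] (X : C) :
    DeltaFunctor (extFunctorLinear R X) where
  δ hS i := ModuleCat.ofHom (hS.extClass.postcompOfLinear R X rfl)
  δ_naturality {S S'} hS hS' f i := by
    ext (x : Ext X _ i)
    change (x.comp (Ext.mk₀ f.τ₃) (add_zero i)).comp hS'.extClass rfl =
      (x.comp hS.extClass rfl).comp (Ext.mk₀ f.τ₁) (add_zero (i + 1))
    rw [Ext.comp_assoc (a₂₃ := 1) x (Ext.mk₀ f.τ₃) hS'.extClass _ (by lia) (by lia),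
      Ext.comp_assoc (a₂₃ := 1) x hS.extClass (Ext.mk₀ f.τ₁) _ (by lia) (by lia),
      ShortComplex.ShortExact.extClass_naturality]
  exact₁ {S} hS i := by
    intro (x : Ext X _ (i + 1))
    constructor
    · intro hx
      exact Ext.covariant_sequence_exact₁ X hS x hx rfl
    · rintro ⟨y : Ext X _ i, rfl⟩
      change (y.comp hS.extClass rfl).comp (Ext.mk₀ S.f) (add_zero (i + 1)) = 0
      rw [Ext.comp_assoc (a₂₃ := 1) y hS.extClass (Ext.mk₀ S.f) _ (by lia) (by lia)]
      simp
  exact₂ {S} hS i := by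
    intro (x : Ext X _ i)
    constructor
    · intro hx
      exact Ext.covariant_sequence_exact₂ X hS x hx
    · rintro ⟨y : Ext X _ i, rfl⟩
      change (y.comp (Ext.mk₀ S.f) (add_zero i)).comp (Ext.mk₀ S.g) (add_zero i) = 0
      rw [Ext.comp_assoc (a₂₃ := 0) y (Ext.mk₀ S.f) (Ext.mk₀ S.g) _ (by lia) (by lia)]
      simp
  exact₃ {S} hS i := by
    intro (x : Ext X _ i)
    constructor
    · intro hx
      exact Ext.covariant_sequence_exact₃ X hS x rfl hx
    · rintro ⟨y : Ext X _ i, rfl⟩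
      change (y.comp (Ext.mk₀ S.g) (add_zero i)).comp hS.extClass rfl = 0
      rw [Ext.comp_assoc (a₂₃ := 1) y (Ext.mk₀ S.g) hS.extClass _ (by lia) (by lia)]
      simp

end DeltaFunctor

end CategoryTheory

namespace ConeHomology

/-! ### Derived limits as Ext from a constant system -/

section LimitDelta

open Abelian

variable (Γ : Type u) [Preorder Γ] (R : Type u) [CommRing R]

instance hasExt_invSystem : HasExt.{u} (Γᵒᵖ ⥤ ModuleCat.{u} R) :=
  hasExt_of_enoughInjectives _

/-- The constant inverse system `R`. -/
noncomputable abbrev constSystem : Γᵒᵖ ⥤ ModuleCat.{u} R :=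
  (Functor.const _).obj (ModuleCat.of R R)

/-- The inverse limit is `Hom(R, -)`, for the constant inverse system `R`. -/
noncomputable def limIsoCoyoneda : (lim : (Γᵒᵖ ⥤ ModuleCat.{u} R) ⥤ ModuleCat.{u} R) ≅
    (linearCoyoneda R (Γᵒᵖ ⥤ ModuleCat.{u} R)).obj (Opposite.op (constSystem Γ R)) :=
  -- A morphism out of the constant system is determined by the images of `1`, which form a
  -- compatible family, that is, an element of the limit.
  NatIso.ofComponents
    (fun F => LinearEquiv.toModuleIso
      (LinearEquiv.ofBijective
        (M := ↑(lim.obj F)) (M₂ := (constSystem Γ R ⟶ F))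
        { toFun x :=
            { app γ := ModuleCat.ofHom (LinearMap.toSpanSingleton R _ ((limit.π F γ).hom x))
              naturality γ γ' f := by
                ext
                simp }
          map_add' x y := by
            ext γ
            simp
          map_smul' r x := by
            ext γ
            simp }
        ⟨fun x y h => Concrete.limit_ext F x y fun γ => by
          have := congrArg (fun k : constSystem Γ R ⟶ F => (k.app γ).hom (1 : R)) h
          simpa using this,
        fun f => ⟨(limit.lift F ⟨_, f⟩).hom (1 : R), by
          ext γ
          simp⟩⟩))
    (fun {F F'} f => by
      ext x
      refine NatTrans.ext (funext fun γ => ModuleCat.hom_ext (LinearMap.ext_ring ?_))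
      have h : (limit.π F' γ).hom ((limMap f).hom x) = (f.app γ).hom ((limit.π F γ).hom x) :=
        congrArg (fun k => k.hom x) (limMap_π f γ)
      change (1 : R) • (limit.π F' γ).hom ((limMap f).hom x) =
        (f.app γ).hom ((1 : R) • (limit.π F γ).hom x)
      rw [h, one_smul, one_smul])

/-- The derived inverse limits, starting with the inverse limit itself. -/
noncomputable def limFamily : ℕ → (Γᵒᵖ ⥤ ModuleCat.{u} R) ⥤ ModuleCat.{u} R
  -- Degree zero is the limit itself and not its zeroth derived functor, so that the canonical map
  -- from the colimit lands in it directly.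
  | 0 => lim
  | (i + 1) => derivedLim Γ R (i + 1)

/-- The derived inverse limits are the functors `Ext R -`, for the constant inverse system `R`. -/
noncomputable def limFamilyIso : ∀ i : ℕ,
    limFamily Γ R i ≅ extFunctorLinear R (constSystem Γ R) i
  | 0 => limIsoCoyoneda Γ R ≪≫ linearCoyonedaIsoExt R _
  | (i + 1) =>
    rightDerivedIso (limIsoCoyoneda Γ R) (i + 1) ≪≫
      rightDerivedLinearCoyonedaIso R (constSystem Γ R) i

/-- The derived inverse limits form a δ-functor. -/
noncomputable def limDelta : DeltaFunctor (limFamily Γ R) :=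
  (extDeltaFunctor R (constSystem Γ R)).ofIso (limFamilyIso Γ R)

end LimitDelta

end ConeHomology

/-! ### Pointwise exactness, extension of maps, projective functors -/

namespace CategoryTheory

lemma shortExact_of_app {R : Type u} [CommRing R] {J : Type*} [Category* J]
    (S : ShortComplex (J ⥤ ModuleCat.{u} R))
    (hf : ∀ j, Function.Injective (S.f.app j))
    (hfg : ∀ j, Function.Exact (S.f.app j) (S.g.app j))
    (hg : ∀ j, Function.Surjective (S.g.app j)) : S.ShortExact where
  exact := by
    rw [S.exact_iff_isZero_homology]
    refine Functor.isZero _ fun j => ?_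
    refine IsZero.of_iso ?_ ((S.mapHomologyIso ((evaluation J (ModuleCat.{u} R)).obj j)).symm)
    rw [← ShortComplex.exact_iff_isZero_homology]
    exact (ShortComplex.ShortExact.moduleCat_exact_iff_function_exact _).2 (hfg j)
  mono_f := by
    have (j : J) : Mono (S.f.app j) := (ModuleCat.mono_iff_injective _).2 (hf j)
    exact NatTrans.mono_of_mono_app _
  epi_g := by
    have (j : J) : Epi (S.g.app j) := (ModuleCat.epi_iff_surjective _).2 (hg j)
    exact NatTrans.epi_of_epi_app _

section

variable {R : Type u} [CommRing R] {J : Type*} [Category* J]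
    {S : ShortComplex (J ⥤ ModuleCat.{u} R)} (hS : S.ShortExact) (j : J)

include hS

lemma ShortComplex.ShortExact.app_shortExact :
    (S.map ((evaluation J (ModuleCat.{u} R)).obj j)).ShortExact :=
  hS.map_of_exact _

lemma ShortComplex.ShortExact.app_injective : Function.Injective (S.f.app j) :=
  (hS.app_shortExact j).moduleCat_injective_f

lemma ShortComplex.ShortExact.app_exact : Function.Exact (S.f.app j) (S.g.app j) :=
  (ShortComplex.ShortExact.moduleCat_exact_iff_function_exact _).1 (hS.app_shortExact j).exact

lemma ShortComplex.ShortExact.app_surjective : Function.Surjective (S.g.app j) :=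
  (hS.app_shortExact j).moduleCat_surjective_g

end

lemma exists_extension_of_injective {R : Type u} [CommRing R] {M N I : ModuleCat.{u} R}
    (hI : Injective I) (f : M →ₗ[R] N) (hf : Function.Injective f) (g : M →ₗ[R] I) :
    ∃ h : N →ₗ[R] I, h ∘ₗ f = g := by
  have : Mono (ModuleCat.ofHom f) := (ModuleCat.mono_iff_injective _).2 hf
  exact ⟨(Injective.factorThru (ModuleCat.ofHom g) (ModuleCat.ofHom f)).hom,
    congrArg ModuleCat.Hom.hom (Injective.comp_factorThru (ModuleCat.ofHom g) (ModuleCat.ofHom f))⟩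

/-- The map `g` factors through M / ker f, which embeds in N; injectivity of I then extends it. -/
lemma exists_extension_of_ker_le {R : Type u} [CommRing R] {M N I : ModuleCat.{u} R}
    (hI : Injective I) (f : M →ₗ[R] N) (g : M →ₗ[R] I)
    (hfg : ∀ x, f x = 0 → g x = 0) : ∃ h : N →ₗ[R] I, h ∘ₗ f = g := by
  obtain ⟨h, hh⟩ := exists_extension_of_injective (M := ModuleCat.of R (M ⧸ LinearMap.ker f))
    (N := N) hI ((LinearMap.ker f).liftQ f le_rfl)
    (LinearMap.ker_eq_bot.1 (Submodule.ker_liftQ_eq_bot _ _ _ le_rfl))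
    ((LinearMap.ker f).liftQ g fun x hx => hfg x hx)
  refine ⟨h, LinearMap.ext fun x => ?_⟩
  exact congrArg (fun k : (M ⧸ LinearMap.ker f) →ₗ[R] I => k (Submodule.Quotient.mk x)) hh

/-- A functor category with values in modules has enough projectives. -/
instance enoughProjectives_functor {R : Type u} [CommRing R] {J : Type u} [SmallCategory J] :
    EnoughProjectives (J ⥤ ModuleCat.{u} R) where
  presentation A := by
    let adj (j : J) := evaluationAdjunctionRight (ModuleCat.{u} R) j
    let P : J → (J ⥤ ModuleCat.{u} R) := fun j =>
      (evaluationLeftAdjoint (ModuleCat.{u} R) j).obj (Projective.over (A.obj j))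
    -- Evaluation at `j` preserves epimorphisms, so its left adjoint preserves projectives. Summing
    -- over all `j` makes the map to `A` epimorphic at each object.
    have (j : J) : Projective (P j) := (adj j).map_projective _ inferInstance
    let f (j : J) : P j ⟶ A := ((adj j).homEquiv _ _).symm (Projective.π (A.obj j))
    let π : ∐ P ⟶ A := Limits.Sigma.desc f
    have (j : J) : Epi (π.app j) := by
      have h : (adj j).unit.app (Projective.over (A.obj j)) ≫ (Limits.Sigma.ι P j).app j ≫
          π.app j = Projective.π (A.obj j) := by
        rw [← NatTrans.comp_app, Limits.Sigma.ι_desc]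
        have := ((adj j).homEquiv _ _).apply_symm_apply (Projective.π (A.obj j))
        rwa [Adjunction.homEquiv_unit] at this
      rw [← Category.assoc] at h
      exact epi_of_epi_fac h
    exact ⟨{ p := ∐ P, f := π, epi := NatTrans.epi_of_epi_app _ }⟩

end CategoryTheory

namespace ConeHomology

/-! ### Vanishing of the higher derived limits of Hom(A_γ, I) -/

section HomSystem

variable {R : Type u} [CommRing R]

/-- The contravariant functor `Hom(-, I)`. -/
noncomputable def homFunctor (I : ModuleCat.{u} R) : (ModuleCat.{u} R)ᵒᵖ ⥤ ModuleCat.{u} R where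
  obj M := ModuleCat.of R (M.unop →ₗ[R] I)
  map f := ModuleCat.ofHom (LinearMap.lcomp R I f.unop.hom)

variable {Γ : Type u} [Preorder Γ]

/-- The inverse system `γ ↦ Hom(A_γ, I)`. -/
noncomputable abbrev homSystem (A : Γ ⥤ ModuleCat.{u} R) (I : ModuleCat.{u} R) :
    Γᵒᵖ ⥤ ModuleCat.{u} R :=
  A.op ⋙ homFunctor I

/-- The morphism of inverse systems induced by a morphism of direct systems. -/
noncomputable abbrev homSystemMap {A A' : Γ ⥤ ModuleCat.{u} R} (f : A ⟶ A')
    (I : ModuleCat.{u} R) : homSystem A' I ⟶ homSystem A I :=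
  Functor.whiskerRight (NatTrans.op f) (homFunctor I)

/-- The direct system `γ ↦ Hom(B_γ, I)`. -/
noncomputable def coHomSystem (B : Γᵒᵖ ⥤ ModuleCat.{u} R) (I : ModuleCat.{u} R) :
    Γ ⥤ ModuleCat.{u} R where
  obj γ := ModuleCat.of R (B.obj (Opposite.op γ) →ₗ[R] I)
  map f := ModuleCat.ofHom (LinearMap.lcomp R I (B.map f.op).hom)

/-- Both sides are the families of bilinear pairings `A_γ × B_γ → I` which are compatible with the
transition maps. -/
noncomputable def flipEquiv (A : Γ ⥤ ModuleCat.{u} R) (B : Γᵒᵖ ⥤ ModuleCat.{u} R)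
    (I : ModuleCat.{u} R) :
    (B ⟶ homSystem A I) ≃ (A ⟶ coHomSystem B I) where
  toFun f :=
    { app γ := ModuleCat.ofHom (f.app (Opposite.op γ)).hom.flip
      naturality γ γ' g := by
        ext a
        refine LinearMap.ext fun b => ?_
        exact (congrArg (fun k => (k.hom b : _ →ₗ[R] I) a) (f.naturality g.op)).symm }
  invFun f :=
    { app γ := ModuleCat.ofHom (f.app γ.unop).hom.flip
      naturality γ γ' g := by
        ext b
        refine LinearMap.ext fun a => ?_
        exact (congrArg (fun k => (k.hom a : _ →ₗ[R] I) b) (f.naturality g.unop)).symm }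
  left_inv f := rfl
  right_inv f := rfl

/-- Under `flipEquiv`, extending a map to Hom(A, I) along a monomorphism B → B' becomes lifting a
map out of A through Hom(B', I) → Hom(B, I). This last map is an epimorphism since I is injective,
so projectivity of A provides the lift. -/
lemma injective_homSystem (A : Γ ⥤ ModuleCat.{u} R) [Projective A] (I : ModuleCat.{u} R)
    (hI : Injective I) : Injective (homSystem A I) where
  factors {B B'} g i hi := by
    let res : coHomSystem B' I ⟶ coHomSystem B I :=
      { app γ := ModuleCat.ofHom (LinearMap.lcomp R I (i.app (Opposite.op γ)).hom)
        naturality γ γ' f := by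
          ext (φ : B'.obj (Opposite.op γ) →ₗ[R] I)
          refine LinearMap.ext fun b => ?_
          exact congrArg (fun y => φ y)
            (congrArg (fun k => k.hom b) (i.naturality f.op)).symm }
    have (γ : Γ) : Epi (res.app γ) := by
      rw [ModuleCat.epi_iff_surjective]
      intro φ
      exact exists_extension_of_injective hI _ ((ModuleCat.mono_iff_injective _).1 inferInstance) φ
    have : Epi res := NatTrans.epi_of_epi_app _
    refine ⟨(flipEquiv A B' I).symm (Projective.factorThru (flipEquiv A B I g) res), ?_⟩
    apply (flipEquiv A B I).injective
    exact Projective.factorThru_comp (flipEquiv A B I g) res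

/-- The short exact sequence of inverse systems obtained from a short exact sequence of direct
systems by applying `Hom(-, I)`. -/
noncomputable def homShortComplex (S : ShortComplex (Γ ⥤ ModuleCat.{u} R)) (I : ModuleCat.{u} R) :
    ShortComplex (Γᵒᵖ ⥤ ModuleCat.{u} R) :=
  ShortComplex.mk (homSystemMap S.g I) (homSystemMap S.f I) (by
    ext γ (φ : S.X₃.obj γ.unop →ₗ[R] I)
    refine LinearMap.ext fun x => ?_
    refine (congrArg (fun y => φ y)
      (congrArg (fun k => (k.app γ.unop).hom x) S.zero)).trans ?_
    exact map_zero φ)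

lemma shortExact_homShortComplex {S : ShortComplex (Γ ⥤ ModuleCat.{u} R)} (hS : S.ShortExact)
    (I : ModuleCat.{u} R) (hI : Injective I) : (homShortComplex S I).ShortExact := by
  apply shortExact_of_app
  · intro γ φ ψ h
    refine LinearMap.ext fun x => ?_
    obtain ⟨y, rfl⟩ := hS.app_surjective γ.unop x
    exact congrArg (fun k : _ →ₗ[R] I => k y) h
  · intro γ (φ : _ →ₗ[R] I)
    constructor
    · intro h
      obtain ⟨ψ, hψ⟩ := exists_extension_of_ker_le hI (S.g.app γ.unop).hom φ (fun x hx => by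
        obtain ⟨y, rfl⟩ := (hS.app_exact γ.unop x).1 hx
        exact congrArg (fun k : _ →ₗ[R] I => k y) h)
      exact ⟨ψ, hψ⟩
    · rintro ⟨ψ : _ →ₗ[R] I, rfl⟩
      refine LinearMap.ext fun x => ?_
      exact (congrArg (fun y => ψ y) ((hS.app_exact γ.unop _).2 ⟨x, rfl⟩)).trans (map_zero ψ)
  · intro γ φ
    exact exists_extension_of_injective hI _ (hS.app_injective γ.unop) φ

variable [IsDirectedOrder Γ] [Nonempty Γ]

/-- This system is constant with value Hom(R, I) ≅ I. The constant functor is right adjoint to the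
colimit, which preserves monomorphisms because Γ is directed and non-empty, so it preserves
injectives. -/
lemma injective_coHomSystem_const (I : ModuleCat.{u} R) (hI : Injective I) :
    Injective (coHomSystem (constSystem Γ R) I) := by
  have : Injective (ModuleCat.of R (R →ₗ[R] I)) :=
    Injective.of_iso (LinearMap.ringLmapEquivSelf R R I).symm.toModuleIso hI
  exact Injective.injective_of_adjoint (colimConstAdj (J := Γ) (C := ModuleCat.{u} R))
    (ModuleCat.of R (R →ₗ[R] I))

open Abelian in
-- Dimension shifting along a projective presentation K → P → A of the direct system. Since Hom(P,
-- I) is injective, a class in degree i + 1 comes from a class of Hom(K, I) in degree i, which the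
-- induction kills when i > 0. When i = 0 that class is a morphism, and it must be lifted to Hom(P,
-- I).
lemma ext_homSystem_eq_zero (A : Γ ⥤ ModuleCat.{u} R) (I : ModuleCat.{u} R)
    (hI : Injective I) (i : ℕ) (x : Ext (constSystem Γ R) (homSystem A I) (i + 1)) : x = 0 := by
  let S := ShortComplex.mk _ _ (kernel.condition (Projective.π A))
  have hS : S.ShortExact :=
    { exact := ShortComplex.exact_of_f_is_kernel _ (kernelIsKernel (Projective.π A))
      epi_g := inferInstanceAs (Epi (Projective.π A)) }
  have hS' := shortExact_homShortComplex hS I hI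
  have : Injective (homShortComplex S I).X₂ := injective_homSystem (Projective.over A) I hI
  obtain ⟨y, rfl⟩ := Ext.covariant_sequence_exact₁ _ hS' x (Ext.eq_zero_of_injective _) rfl
  cases i with
  | zero =>
    obtain ⟨g, rfl⟩ := Ext.addEquiv₀.symm.surjective y
    have := injective_coHomSystem_const (Γ := Γ) I hI
    have : Mono S.f := inferInstanceAs (Mono (kernel.ι _))
    -- After flipping, the lift is an extension along K → P of a map into the injective system
    -- Hom(R, I).
    let h : constSystem Γ R ⟶ (homShortComplex S I).X₂ :=
      (flipEquiv S.X₂ _ I).symm (Injective.factorThru (flipEquiv S.X₁ _ I g) S.f)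
    have hg : h ≫ (homShortComplex S I).g = g :=
      (flipEquiv S.X₁ _ I).injective (Injective.comp_factorThru (flipEquiv S.X₁ _ I g) S.f)
    have : Ext.addEquiv₀.symm g = (Ext.mk₀ h).comp (Ext.mk₀ (homShortComplex S I).g)
        (add_zero 0) := by
      rw [Ext.mk₀_comp_mk₀]
      exact congrArg Ext.mk₀ hg.symm
    rw [this, Ext.comp_assoc (a₂₃ := 1) _ _ _ _ (by lia) (by lia)]
    simp
    rfl
  | succ i =>
    have hy : y = 0 := ext_homSystem_eq_zero S.X₁ I hI i y
    rw [hy, Ext.zero_comp]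
    rfl

lemma subsingleton_limFamily_homSystem (A : Γ ⥤ ModuleCat.{u} R) (I : ModuleCat.{u} R)
    (hI : Injective I) (i : ℕ) :
    Subsingleton ((limFamily Γ R (i + 1)).obj (homSystem A I)) :=
  have : Subsingleton ((extFunctorLinear R (constSystem Γ R) (i + 1)).obj (homSystem A I)) :=
    subsingleton_of_forall_eq 0 (ext_homSystem_eq_zero A I hI i)
  ((limFamilyIso Γ R (i + 1)).app (homSystem A I)).toLinearEquiv.toEquiv.subsingleton

end HomSystem

end ConeHomology

namespace ConeHomology

/-! ### Cycles, boundaries and homology as functors of the complex -/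

section Subfunctors

variable {R : Type u} [CommRing R]

/-- The category of contravariant functors from cochain complexes to modules. -/
abbrev ComplexFunctor (R : Type u) [CommRing R] :=
  (CochainComplex (ModuleCat.{u} R) ℤ)ᵒᵖ ⥤ ModuleCat.{u} R

lemma d_comp_d_apply (C : CochainComplex (ModuleCat.{u} R) ℤ) (i j k : ℤ) (x : C.X i) :
    (C.d j k).hom ((C.d i j).hom x) = 0 :=
  congrArg (fun f => f.hom x) (C.d_comp_d i j k)

lemma hom_comm_apply {C D : CochainComplex (ModuleCat.{u} R) ℤ} (f : C ⟶ D) (i j : ℤ)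
    (x : C.X i) : (D.d i j).hom ((f.f i).hom x) = (f.f j).hom ((C.d i j).hom x) :=
  congrArg (fun f => f.hom x) (f.comm i j)

variable (G' G'' : ModuleCat.{u} R)

/-- The module of chains of degree `n`. -/
abbrev Chain (n : ℤ) (C : CochainComplex (ModuleCat.{u} R) ℤ) : Type u :=
  (C.X n →ₗ[R] G') × (C.X (n + 1) →ₗ[R] G'')

/-- The chains of degree `n`, as a functor of the cochain complex. -/
noncomputable def chainFunctor (n : ℤ) : ComplexFunctor R where
  obj C := ModuleCat.of R (Chain G' G'' n C.unop)
  map f := ModuleCat.ofHom (coneMapDeg G' G'' f.unop n)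

/-- A natural family of submodules of the modules of chains of degree `n`. -/
structure ChainSub (n : ℤ) where
  /-- the submodules -/
  carrier (C : CochainComplex (ModuleCat.{u} R) ℤ) : Submodule R (Chain G' G'' n C)
  map_mem {C D : CochainComplex (ModuleCat.{u} R) ℤ} (f : C ⟶ D) (φ : Chain G' G'' n D) :
    φ ∈ carrier D → coneMapDeg G' G'' f n φ ∈ carrier C

variable {G' G''}

/-- The functor underlying a natural family of submodules. -/
noncomputable def ChainSub.functor {n : ℤ} (P : ChainSub G' G'' n) : ComplexFunctor R where
  obj C := ModuleCat.of R (P.carrier C.unop)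
  map f := ModuleCat.ofHom ((coneMapDeg G' G'' f.unop n).restrict (P.map_mem f.unop))

/-- The inclusion into the chains. -/
noncomputable def ChainSub.ι {n : ℤ} (P : ChainSub G' G'' n) :
    P.functor ⟶ chainFunctor G' G'' n where
  app C := ModuleCat.ofHom (P.carrier C.unop).subtype

/-- The inclusion of one family of submodules into another. -/
noncomputable def ChainSub.incl {n : ℤ} {P Q : ChainSub G' G'' n}
    (h : ∀ C, P.carrier C ≤ Q.carrier C) : P.functor ⟶ Q.functor where
  app C := ModuleCat.ofHom (Submodule.inclusion (h C.unop))

variable (β : G' ⟶ G'')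

lemma coneBoundary_coneMapDeg {C D : CochainComplex (ModuleCat.{u} R) ℤ} (f : C ⟶ D) (n : ℤ)
    (φ : Chain G' G'' (n + 1) D) :
    coneBoundary β C n (coneMapDeg G' G'' f (n + 1) φ) =
      coneMapDeg G' G'' f n (coneBoundary β D n φ) := by
  apply Prod.ext
  · apply LinearMap.ext
    intro x
    exact congrArg φ.1 (hom_comm_apply f _ _ x).symm
  · apply LinearMap.ext
    intro x
    exact congrArg (fun y => β.hom (φ.1 ((f.f _).hom x)) - φ.2 y) (hom_comm_apply f _ _ x).symm

/-- The cycles of degree `n`. -/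
def cycleSub (n : ℤ) : ChainSub G' G'' n where
  carrier C :=
    -- Quantifying over all `j` avoids writing `n` as a successor; differentials that do not come
    -- from degree `n - 1` are zero and impose nothing.
    { carrier := { φ | (∀ j x, φ.1 ((C.d j n).hom x) = 0) ∧
        ∀ x, β.hom (φ.1 x) = φ.2 ((C.d n (n + 1)).hom x) }
      add_mem' := by
        rintro φ ψ ⟨h₁, h₂⟩ ⟨h₃, h₄⟩
        exact ⟨fun j x => by simp [h₁, h₃], fun x => by simp [h₂, h₄]⟩
      zero_mem' := ⟨fun j x => rfl, fun x => by simp⟩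
      smul_mem' := by
        rintro r φ ⟨h₁, h₂⟩
        exact ⟨fun j x => by simp [h₁], fun x => by simp [h₂]⟩ }
  map_mem {C D} f φ := by
    rintro ⟨h₁, h₂⟩
    refine ⟨fun j x => ?_, fun x => ?_⟩
    · exact (congrArg φ.1 (hom_comm_apply f _ _ x).symm).trans (h₁ _ _)
    · exact (h₂ _).trans (congrArg φ.2 (hom_comm_apply f _ _ x))

lemma mem_cycleSub_iff (n : ℤ) (C : CochainComplex (ModuleCat.{u} R) ℤ)
    (φ : Chain G' G'' (n + 1) C) :
    φ ∈ (cycleSub β (n + 1)).carrier C ↔ coneBoundary β C n φ = 0 := by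
  constructor
  · rintro ⟨h₁, h₂⟩
    refine Prod.ext (LinearMap.ext fun x => h₁ n x) (LinearMap.ext fun x => ?_)
    exact sub_eq_zero.2 (h₂ x)
  · intro h
    refine ⟨fun j x => ?_, fun x => ?_⟩
    · by_cases hj : j + 1 = n + 1
      · obtain rfl : j = n := by lia
        exact congrArg (fun ψ => ψ.1 x) h
      · rw [C.shape _ _ (by simpa using hj)]
        simp
    · exact sub_eq_zero.1 (congrArg (fun ψ => ψ.2 x) h)

/-- The boundaries of degree `n`. -/
def boundarySub (n : ℤ) : ChainSub G' G'' n where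
  carrier C := LinearMap.range (coneBoundary β C n)
  map_mem {C D} f φ := by
    rintro ⟨ψ, rfl⟩
    exact ⟨_, coneBoundary_coneMapDeg β f n ψ⟩

/-- The cycles of degree `n` whose first component vanishes on the cocycles. -/
def vanishingSub (n : ℤ) : ChainSub G' G'' n where
  carrier C :=
    { carrier := { φ | φ ∈ (cycleSub β n).carrier C ∧
        ∀ x, (C.d n (n + 1)).hom x = 0 → φ.1 x = 0 }
      add_mem' := by
        rintro φ ψ ⟨h₁, h₂⟩ ⟨h₃, h₄⟩
        exact ⟨add_mem h₁ h₃, fun x hx => by simp [h₂ x hx, h₄ x hx]⟩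
      zero_mem' := ⟨zero_mem _, fun x _ => rfl⟩
      smul_mem' := by
        rintro r φ ⟨h₁, h₂⟩
        exact ⟨Submodule.smul_mem _ r h₁, fun x hx => by simp [h₂ x hx]⟩ }
  map_mem {C D} f φ := by
    rintro ⟨h₁, h₂⟩
    refine ⟨(cycleSub β n).map_mem f φ h₁, fun x hx => h₂ _ ?_⟩
    rw [hom_comm_apply, hx, map_zero]

/-- The first component of a boundary is φ' ∘ δ, which is zero on cocycles. -/
lemma boundary_le_vanishing (n : ℤ) (C : CochainComplex (ModuleCat.{u} R) ℤ) :
    (boundarySub β n).carrier C ≤ (vanishingSub β n).carrier C := by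
  rintro _ ⟨ψ, rfl⟩
  refine ⟨⟨fun j x => ?_, fun x => ?_⟩, fun x hx => ?_⟩
  · exact (congrArg ψ.1 (d_comp_d_apply C _ _ _ x)).trans (map_zero _)
  · refine (Eq.trans ?_ (congrArg (fun y => β.hom (ψ.1 ((C.d n (n + 1)).hom x)) - ψ.2 y)
      (d_comp_d_apply C n (n + 1) (n + 1 + 1) x)).symm)
    simp
    rfl
  · exact (congrArg ψ.1 hx).trans (map_zero _)

lemma vanishing_le_cycle (n : ℤ) (C : CochainComplex (ModuleCat.{u} R) ℤ) :
    (vanishingSub β n).carrier C ≤ (cycleSub β n).carrier C := fun _ h => h.1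

lemma boundary_le_cycle (n : ℤ) (C : CochainComplex (ModuleCat.{u} R) ℤ) :
    (boundarySub β n).carrier C ≤ (cycleSub β n).carrier C :=
  (boundary_le_vanishing β n C).trans (vanishing_le_cycle β n C)

/-- The boundary, as a natural transformation onto the boundaries. -/
noncomputable def toBoundary (n : ℤ) :
    chainFunctor G' G'' (n + 1) ⟶ (boundarySub β n).functor where
  app C := ModuleCat.ofHom (coneBoundary β C.unop n).rangeRestrict
  naturality C D f := by
    ext φ
    exact Subtype.ext (coneBoundary_coneMapDeg β f.unop n φ)

/-- The short exact sequence of cycles, chains and boundaries. -/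
noncomputable def boundarySequence (n : ℤ) : ShortComplex (ComplexFunctor R) :=
  ShortComplex.mk (cycleSub β (n + 1)).ι (toBoundary β n) (by
    ext C φ
    exact Subtype.ext ((mem_cycleSub_iff β n C.unop _).1 φ.2))

lemma shortExact_boundarySequence (n : ℤ) : (boundarySequence β n).ShortExact := by
  apply CategoryTheory.shortExact_of_app
  · intro C
    exact Subtype.val_injective
  · intro C (φ : Chain G' G'' (n + 1) C.unop)
    constructor
    · intro h
      exact ⟨(⟨φ, (mem_cycleSub_iff β n C.unop φ).2 (congrArg Subtype.val h)⟩ :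
        (cycleSub β (n + 1)).carrier C.unop), rfl⟩
    · rintro ⟨ψ, rfl⟩
      exact Subtype.ext ((mem_cycleSub_iff β n C.unop _).1 ψ.2)
  · intro C
    exact LinearMap.surjective_rangeRestrict (coneBoundary β C.unop n)

/-- The inclusion of the cycles into the cone. -/
noncomputable def cycleInclusion (n : ℤ) (C : CochainComplex (ModuleCat.{u} R) ℤ) :
    ModuleCat.of R ((cycleSub β n).carrier C) ⟶ (cone β C).X n :=
  ModuleCat.ofHom ((cycleSub β n).carrier C).subtype

lemma cycleInclusion_d (n : ℤ) (C : CochainComplex (ModuleCat.{u} R) ℤ) :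
    cycleInclusion β n C ≫ (cone β C).d n (n - 1) = 0 := by
  obtain ⟨m, rfl⟩ : ∃ m, n = m + 1 := ⟨n - 1, by lia⟩
  rw [show m + 1 - 1 = m by lia, cone_d]
  ext φ
  exact (mem_cycleSub_iff β m C _).1 φ.2

lemma d_eq_zero_of_mem_cycleSub (n j : ℤ) (C : CochainComplex (ModuleCat.{u} R) ℤ) :
    cycleInclusion β n C ≫ (cone β C).d n j = 0 := by
  by_cases h : j = n - 1
  · rw [h, cycleInclusion_d]
  · rw [(cone β C).shape n j (fun h' => h (by simp at h'; lia)), comp_zero]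

/-- The projection of the cycles onto the homology, for a given cochain complex. -/
noncomputable def toHomologyApp (n : ℤ) (C : CochainComplex (ModuleCat.{u} R) ℤ) :
    ModuleCat.of R ((cycleSub β n).carrier C) ⟶ (cone β C).homology n :=
  (cone β C).liftCycles (cycleInclusion β n C) _ rfl (d_eq_zero_of_mem_cycleSub β n _ C) ≫
    (cone β C).homologyπ n

/-- The projection of the cycles onto the homology. -/
noncomputable def toHomology (n : ℤ) : (cycleSub β n).functor ⟶ barHomology β n where
  app C := toHomologyApp β n C.unop
  naturality C D f := by
    change _ ≫ toHomologyApp β n D.unop =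
      toHomologyApp β n C.unop ≫ HomologicalComplex.homologyMap (coneMap β f.unop) n
    rw [toHomologyApp, toHomologyApp, Category.assoc, HomologicalComplex.homologyπ_naturality,
      HomologicalComplex.liftCycles_comp_cyclesMap_assoc]
    exact HomologicalComplex.comp_liftCycles_assoc (cone β D.unop) (cycleInclusion β n D.unop) _
      rfl (d_eq_zero_of_mem_cycleSub β n _ D.unop)
      (ModuleCat.ofHom ((coneMapDeg G' G'' f.unop n).restrict ((cycleSub β n).map_mem f.unop))) _

lemma toHomology_eq_zero_iff (n : ℤ) (C : (CochainComplex (ModuleCat.{u} R) ℤ)ᵒᵖ)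
    (φ : (cycleSub β n).functor.obj C) :
    (toHomology β n).app C φ = 0 ↔ φ.1 ∈ (boundarySub β n).carrier C.unop := by
  let K := cone β C.unop
  have hK : K.d (n + 1) n = ModuleCat.ofHom (coneBoundary β C.unop n) := cone_d β C.unop n
  let z : K.cycles n := (K.liftCycles (cycleInclusion β n C.unop) _ rfl
    (d_eq_zero_of_mem_cycleSub β n _ C.unop)).hom φ
  have hz : (K.iCycles n).hom z = φ.1 := congrArg (fun f => f.hom φ)
    (K.liftCycles_i (cycleInclusion β n C.unop) _ rfl (d_eq_zero_of_mem_cycleSub β n _ C.unop))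
  have inj : Function.Injective (K.iCycles n).hom :=
    (ModuleCat.mono_iff_injective _).1 inferInstance
  have ex := (ShortComplex.ShortExact.moduleCat_exact_iff_function_exact
    (ShortComplex.mk _ _ (K.toCycles_comp_homologyπ (n + 1) n))).1
    (ShortComplex.exact_of_g_is_cokernel _ (K.homologyIsCokernel (n + 1) n (by simp)))
  have hi (y) : (K.iCycles n).hom ((K.toCycles (n + 1) n).hom y) = coneBoundary β C.unop n y := by
    refine (congrArg (fun f => f.hom y) (K.toCycles_i (n + 1) n)).trans ?_
    rw [hK]
    rfl
  refine (ex z).trans ⟨?_, ?_⟩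
  · rintro ⟨y, hy⟩
    exact ⟨y, (hi y).symm.trans ((congrArg (K.iCycles n).hom hy).trans hz)⟩
  · rintro ⟨y, hy⟩
    exact ⟨y, inj ((hi y).trans (hy.trans hz.symm))⟩

lemma toHomology_surjective (n : ℤ) (C : (CochainComplex (ModuleCat.{u} R) ℤ)ᵒᵖ) :
    Function.Surjective ((toHomology β n).app C) := by
  let K := cone β C.unop
  intro x
  obtain ⟨z, rfl⟩ := HomologicalComplex.homologyπ_surjective K n x
  have inj : Function.Injective (K.iCycles n).hom :=
    (ModuleCat.mono_iff_injective _).1 inferInstance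
  have hφ : (K.iCycles n).hom z ∈ (cycleSub β n).carrier C.unop := by
    obtain ⟨m, rfl⟩ : ∃ m, n = m + 1 := ⟨n - 1, by lia⟩
    refine (mem_cycleSub_iff β m C.unop _).2 ?_
    have h := congrArg (fun f => f.hom z) (K.iCycles_d (m + 1) m)
    rwa [show K.d (m + 1) m = ModuleCat.ofHom (coneBoundary β C.unop m) from
      cone_d β C.unop m] at h
  refine ⟨(⟨(K.iCycles n).hom z, hφ⟩ : (cycleSub β n).carrier C.unop), ?_⟩
  refine congrArg (K.homologyπ n).hom (inj ?_)
  exact congrArg (fun f => f.hom (⟨(K.iCycles n).hom z, hφ⟩ : (cycleSub β n).carrier C.unop))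
    (K.liftCycles_i (cycleInclusion β n C.unop) _ rfl (d_eq_zero_of_mem_cycleSub β n _ C.unop))

/-- The short exact sequence of boundaries, cycles and homology. -/
noncomputable def homologySequence (n : ℤ) : ShortComplex (ComplexFunctor R) :=
  ShortComplex.mk (ChainSub.incl (boundary_le_cycle β n)) (toHomology β n) (by
    ext C φ
    exact (toHomology_eq_zero_iff β n C _).2 φ.2)

lemma shortExact_homologySequence (n : ℤ) : (homologySequence β n).ShortExact := by
  apply CategoryTheory.shortExact_of_app
  · intro C
    exact Submodule.inclusion_injective (boundary_le_cycle β n C.unop)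
  · intro C φ
    refine (toHomology_eq_zero_iff β n C φ).trans ⟨fun h => ⟨⟨φ.1, h⟩, rfl⟩, ?_⟩
    rintro ⟨ψ, rfl⟩
    exact ψ.2
  · exact toHomology_surjective β n

lemma shortExact_cokernel {X Y : ComplexFunctor R} (f : X ⟶ Y)
    (hf : ∀ C, Function.Injective (f.app C)) :
    (ShortComplex.mk f (cokernel.π f) (cokernel.condition f)).ShortExact where
  exact := ShortComplex.exact_of_g_is_cokernel _ (cokernelIsCokernel f)
  mono_f := by
    have h (C) : Mono (f.app C) := (ModuleCat.mono_iff_injective _).2 (hf C)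
    exact NatTrans.mono_of_mono_app f
  epi_g := inferInstanceAs (Epi (cokernel.π f))

/-- The short exact sequence with the inclusion of the cycles whose first component vanishes on
cocycles. -/
noncomputable def vanishingSequence (n : ℤ) : ShortComplex (ComplexFunctor R) :=
  ShortComplex.mk (ChainSub.incl (vanishing_le_cycle β n))
    (cokernel.π (ChainSub.incl (vanishing_le_cycle β n))) (cokernel.condition _)

lemma shortExact_vanishingSequence (n : ℤ) : (vanishingSequence β n).ShortExact :=
  shortExact_cokernel (ChainSub.incl (vanishing_le_cycle β n))
    fun C => Submodule.inclusion_injective (vanishing_le_cycle β n C.unop)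

lemma exists_desc {S : ShortComplex (ComplexFunctor R)} (hS : S.ShortExact)
    {X : ComplexFunctor R} (g : S.X₂ ⟶ X) (hg : S.f ≫ g = 0) : ∃ q, S.g ≫ q = g := by
  have := hS.epi_g
  exact ⟨hS.exact.desc g hg, hS.exact.g_desc _ _⟩

/-- Boundaries lie in L_n, so the projection Z_n → Z_n/L_n kills them and descends to homology. This
is the source of the retraction on derived limits. -/
lemma exists_factorization (n : ℤ) : ∃ q : barHomology β n ⟶ (vanishingSequence β n).X₃,
    toHomology β n ≫ q = (vanishingSequence β n).g := by
  refine exists_desc (shortExact_homologySequence β n) (vanishingSequence β n).g ?_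
  exact (Category.assoc (ChainSub.incl (boundary_le_vanishing β n)) (vanishingSequence β n).f
    (vanishingSequence β n).g).trans
      ((congrArg (fun g => _ ≫ g) (vanishingSequence β n).zero).trans comp_zero)

end Subfunctors

end ConeHomology

namespace ConeHomology

/-! ### Chains and vanishing cycles as extensions of Hom functors -/

section Acyclic

variable {R : Type u} [CommRing R] {G' G'' : ModuleCat.{u} R}

/-- The cochains of degree `n` modulo coboundaries. -/
noncomputable def coboundaryQuotient (R : Type u) [CommRing R] (n : ℤ) :
    CochainComplex (ModuleCat.{u} R) ℤ ⥤ ModuleCat.{u} R where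
  obj C := ModuleCat.of R (C.X (n + 1) ⧸ LinearMap.range (C.d n (n + 1)).hom)
  map {C D} f := ModuleCat.ofHom (Submodule.mapQ _ _ (f.f (n + 1)).hom (by
    rintro _ ⟨x, rfl⟩
    exact ⟨(f.f n).hom x, hom_comm_apply f n (n + 1) x⟩))
  map_id C := by
    ext x
    rfl
  map_comp f g := by
    ext x
    rfl

/-- The cochains of degree `n` modulo cocycles. -/
noncomputable def cocycleQuotient (R : Type u) [CommRing R] (n : ℤ) :
    CochainComplex (ModuleCat.{u} R) ℤ ⥤ ModuleCat.{u} R where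
  obj C := ModuleCat.of R (C.X n ⧸ LinearMap.ker (C.d n (n + 1)).hom)
  map {C D} f := ModuleCat.ofHom (Submodule.mapQ _ _ (f.f n).hom (by
    intro x hx
    change (D.d n (n + 1)).hom ((f.f n).hom x) = 0
    rw [hom_comm_apply, show (C.d n (n + 1)).hom x = 0 from hx, map_zero]))
  map_id C := by
    ext x
    rfl
  map_comp f g := by
    ext x
    rfl

/-- The short exact sequence of the two components of the chains. -/
noncomputable def chainSequence (G' G'' : ModuleCat.{u} R) (n : ℤ) :
    ShortComplex (ComplexFunctor R) where
  X₁ := (HomologicalComplex.eval (ModuleCat.{u} R) (ComplexShape.up ℤ) (n + 1)).op ⋙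
    homFunctor G''
  X₂ := chainFunctor G' G'' n
  X₃ := (HomologicalComplex.eval (ModuleCat.{u} R) (ComplexShape.up ℤ) n).op ⋙ homFunctor G'
  f :=
    { app C := ModuleCat.ofHom (X := C.unop.X (n + 1) →ₗ[R] G'') (Y := Chain G' G'' n C.unop)
        (LinearMap.inr R (C.unop.X n →ₗ[R] G') (C.unop.X (n + 1) →ₗ[R] G''))
      naturality _ _ _ := rfl }
  g :=
    { app C := ModuleCat.ofHom (X := Chain G' G'' n C.unop) (Y := C.unop.X n →ₗ[R] G')
        (LinearMap.fst R (C.unop.X n →ₗ[R] G') (C.unop.X (n + 1) →ₗ[R] G''))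
      naturality _ _ _ := rfl }
  zero := rfl

lemma shortExact_chainSequence (n : ℤ) : (chainSequence G' G'' n).ShortExact := by
  apply CategoryTheory.shortExact_of_app
  · intro C
    exact LinearMap.inr_injective (R := R) (M := C.unop.X n →ₗ[R] G')
      (M₂ := C.unop.X (n + 1) →ₗ[R] G'')
  · intro C (φ : Chain G' G'' n C.unop)
    constructor
    · intro h
      exact ⟨φ.2, Prod.ext (Eq.symm h) rfl⟩
    · rintro ⟨ψ, rfl⟩
      rfl
  · intro C ψ
    exact ⟨((ψ, 0) : Chain G' G'' n C.unop), rfl⟩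

variable (β : G' ⟶ G'')

/-- The cycles whose first component is zero. -/
def ofCoboundaryQuotient (n : ℤ) (C : CochainComplex (ModuleCat.{u} R) ℤ) :
    ((C.X (n + 1) ⧸ LinearMap.range (C.d n (n + 1)).hom) →ₗ[R] G'') →ₗ[R]
      (vanishingSub β n).carrier C where
  toFun ψ := ⟨(0, ψ ∘ₗ Submodule.mkQ _), ⟨fun j x => rfl, fun x => by
    have : Submodule.Quotient.mk (p := LinearMap.range (C.d n (n + 1)).hom)
      ((C.d n (n + 1)).hom x) = 0 := (Submodule.Quotient.mk_eq_zero _).2 ⟨x, rfl⟩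
    simp [this]⟩, fun x _ => rfl⟩
  map_add' ψ ψ' := Subtype.ext (Prod.ext (add_zero 0).symm rfl)
  map_smul' r ψ := Subtype.ext (Prod.ext (smul_zero r).symm rfl)

/-- The first component of a cycle which vanishes on cocycles. -/
def toCocycleQuotient (n : ℤ) (C : CochainComplex (ModuleCat.{u} R) ℤ) :
    (vanishingSub β n).carrier C →ₗ[R]
      ((C.X n ⧸ LinearMap.ker (C.d n (n + 1)).hom) →ₗ[R] G') where
  toFun φ := Submodule.liftQ _ φ.1.1 fun x hx => φ.2.2 x hx
  map_add' φ φ' := by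
    ext x
    rfl
  map_smul' r φ := by
    ext x
    rfl

/-- A cycle which vanishes on cocycles is a pair consisting of a map on the cochains modulo
cocycles and of an extension of this map. -/
noncomputable def vanishingComponents (n : ℤ) : ShortComplex (ComplexFunctor R) where
  X₁ := (coboundaryQuotient R n).op ⋙ homFunctor G''
  X₂ := (vanishingSub β n).functor
  X₃ := (cocycleQuotient R n).op ⋙ homFunctor G'
  f :=
    { app C := ModuleCat.ofHom (ofCoboundaryQuotient β n C.unop)
      naturality _ _ _ := rfl }
  g :=
    { app C := ModuleCat.ofHom (toCocycleQuotient β n C.unop)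
      naturality C D f := by
        ext φ
        refine LinearMap.ext fun x => ?_
        obtain ⟨x, rfl⟩ := Submodule.Quotient.mk_surjective _ x
        rfl }
  zero := by
    ext C φ
    refine LinearMap.ext fun x => ?_
    obtain ⟨x, rfl⟩ := Submodule.Quotient.mk_surjective _ x
    rfl

/-- A first component vanishing on cocycles is a map ψ on C^n modulo cocycles. The second component
must then restrict to β ∘ ψ along δ, and two choices differ by a map that kills coboundaries. -/
lemma shortExact_vanishingComponents (hG'' : Injective G'') (n : ℤ) :
    (vanishingComponents β n).ShortExact := by
  apply CategoryTheory.shortExact_of_app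
  · intro C ψ ψ' h
    refine LinearMap.ext fun x => ?_
    obtain ⟨x, rfl⟩ := Submodule.Quotient.mk_surjective _ x
    exact congrArg (fun φ : (vanishingSub β n).carrier C.unop => φ.1.2 x) h
  · intro C (φ : (vanishingSub β n).carrier C.unop)
    constructor
    · intro h
      have h₁ : φ.1.1 = 0 := LinearMap.ext fun x =>
        congrArg (fun k : (C.unop.X n ⧸ LinearMap.ker (C.unop.d n (n + 1)).hom) →ₗ[R] G' =>
          k (Submodule.Quotient.mk x)) h
      refine ⟨Submodule.liftQ (LinearMap.range (C.unop.d n (n + 1)).hom) φ.1.2 ?_, ?_⟩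
      · rintro _ ⟨x, rfl⟩
        refine (φ.2.1.2 x).symm.trans ?_
        rw [h₁]
        exact map_zero β.hom
      · exact Subtype.ext (Prod.ext h₁.symm (LinearMap.ext fun x => rfl))
    · rintro ⟨ψ, rfl⟩
      refine LinearMap.ext fun x => ?_
      obtain ⟨x, rfl⟩ := Submodule.Quotient.mk_surjective _ x
      rfl
  · intro C (ψ : (C.unop.X n ⧸ LinearMap.ker (C.unop.d n (n + 1)).hom) →ₗ[R] G')
    -- Because ψ is defined modulo cocycles, β ∘ ψ is a well-defined map on the image of δ, and
    -- injectivity of G'' extends it to C^{n+1}.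
    obtain ⟨φ'', h⟩ := exists_extension_of_ker_le hG'' (C.unop.d n (n + 1)).hom
      (β.hom ∘ₗ ψ ∘ₗ Submodule.mkQ _) (fun x hx => by
        have : Submodule.Quotient.mk (p := LinearMap.ker (C.unop.d n (n + 1)).hom) x = 0 :=
          (Submodule.Quotient.mk_eq_zero _).2 hx
        simp [this])
    refine ⟨(⟨(ψ ∘ₗ Submodule.mkQ _, φ''), ⟨fun j x => ?_, fun x => ?_⟩, fun x hx => ?_⟩ :
      (vanishingSub β n).carrier C.unop), ?_⟩
    · have : Submodule.Quotient.mk (p := LinearMap.ker (C.unop.d n (n + 1)).hom)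
        ((C.unop.d j n).hom x) = 0 :=
          (Submodule.Quotient.mk_eq_zero _).2 (d_comp_d_apply C.unop j n (n + 1) x)
      simp [this]
    · exact (congrArg (fun k => k x) h).symm
    · have : Submodule.Quotient.mk (p := LinearMap.ker (C.unop.d n (n + 1)).hom) x = 0 :=
        (Submodule.Quotient.mk_eq_zero _).2 hx
      simp [this]
    · refine LinearMap.ext fun x => ?_
      obtain ⟨x, rfl⟩ := Submodule.Quotient.mk_surjective _ x
      rfl

end Acyclic

/-! ### Derived limits applied to natural exact sequences -/

section Systems

variable (Γ : Type u) [Preorder Γ] {R : Type u} [CommRing R]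

/-- The inverse system obtained by applying a contravariant functor to a direct system of cochain
complexes, functorially in the direct system. -/
noncomputable abbrev systemFunctor (X : ComplexFunctor R) :
    (Γ ⥤ CochainComplex (ModuleCat.{u} R) ℤ)ᵒᵖ ⥤ (Γᵒᵖ ⥤ ModuleCat.{u} R) :=
  Functor.opHom Γ (CochainComplex (ModuleCat.{u} R) ℤ) ⋙ (Functor.whiskeringRight _ _ _).obj X

/-- The derived limits of the inverse systems obtained from a contravariant functor. -/
noncomputable abbrev derivedTerm (i : ℕ) (X : ComplexFunctor R) :
    (Γ ⥤ CochainComplex (ModuleCat.{u} R) ℤ)ᵒᵖ ⥤ ModuleCat.{u} R :=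
  systemFunctor Γ X ⋙ limFamily Γ R i

/-- Functoriality of the derived limits in the contravariant functor. -/
noncomputable def derivedMap (i : ℕ) {X Y : ComplexFunctor R} (f : X ⟶ Y) :
    derivedTerm Γ i X ⟶ derivedTerm Γ i Y :=
  Functor.whiskerRight
    (Functor.whiskerLeft (Functor.opHom Γ (CochainComplex (ModuleCat.{u} R) ℤ))
      ((Functor.whiskeringRight _ _ _).map f)) (limFamily Γ R i)

lemma derivedMap_comp (i : ℕ) {X Y Z : ComplexFunctor R} (f : X ⟶ Y) (g : Y ⟶ Z) :
    derivedMap Γ i (f ≫ g) = derivedMap Γ i f ≫ derivedMap Γ i g := by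
  refine NatTrans.ext (funext fun C => ?_)
  exact (limFamily Γ R i).map_comp (Functor.whiskerLeft C.unop.op f)
    (Functor.whiskerLeft C.unop.op g)

variable {Γ} in
/-- A short exact sequence of contravariant functors, applied to a direct system. -/
noncomputable def systemSequence (S : ShortComplex (ComplexFunctor R))
    (C : (Γ ⥤ CochainComplex (ModuleCat.{u} R) ℤ)ᵒᵖ) : ShortComplex (Γᵒᵖ ⥤ ModuleCat.{u} R) :=
  ShortComplex.mk (X₁ := (systemFunctor Γ S.X₁).obj C) (X₂ := (systemFunctor Γ S.X₂).obj C)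
    (X₃ := (systemFunctor Γ S.X₃).obj C)
    (Functor.whiskerLeft C.unop.op S.f) (Functor.whiskerLeft C.unop.op S.g) (by
      rw [← Functor.whiskerLeft_comp, S.zero]
      rfl)

variable {Γ} in
lemma shortExact_systemSequence {S : ShortComplex (ComplexFunctor R)} (hS : S.ShortExact)
    (C : (Γ ⥤ CochainComplex (ModuleCat.{u} R) ℤ)ᵒᵖ) : (systemSequence S C).ShortExact :=
  CategoryTheory.shortExact_of_app _ (fun γ => hS.app_injective (C.unop.op.obj γ))
    (fun γ => hS.app_exact (C.unop.op.obj γ)) (fun γ => hS.app_surjective (C.unop.op.obj γ))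

/-- The connecting homomorphism of the derived limits. -/
noncomputable def connecting {S : ShortComplex (ComplexFunctor R)} (hS : S.ShortExact) (i : ℕ) :
    derivedTerm Γ i S.X₃ ⟶ derivedTerm Γ (i + 1) S.X₁ where
  app C := (limDelta Γ R).δ (shortExact_systemSequence hS C) i
  naturality C D f :=
    (limDelta Γ R).δ_naturality (shortExact_systemSequence hS C) (shortExact_systemSequence hS D)
      { τ₁ := (systemFunctor Γ S.X₁).map f
        τ₂ := (systemFunctor Γ S.X₂).map f
        τ₃ := (systemFunctor Γ S.X₃).map f
        comm₁₂ := by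
          ext γ : 2
          exact S.f.naturality _
        comm₂₃ := by
          ext γ : 2
          exact S.g.naturality _ } i

section Exact

variable {S : ShortComplex (ComplexFunctor R)} (hS : S.ShortExact) (i : ℕ)
  (C : (Γ ⥤ CochainComplex (ModuleCat.{u} R) ℤ)ᵒᵖ)

lemma exact_connecting_derivedMap :
    Function.Exact ((connecting Γ hS i).app C) ((derivedMap Γ (i + 1) S.f).app C) :=
  (limDelta Γ R).exact₁ (shortExact_systemSequence hS C) i

include hS in
lemma exact_derivedMap_derivedMap :
    Function.Exact ((derivedMap Γ i S.f).app C) ((derivedMap Γ i S.g).app C) :=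
  (limDelta Γ R).exact₂ (shortExact_systemSequence hS C) i

lemma exact_derivedMap_connecting :
    Function.Exact ((derivedMap Γ i S.g).app C) ((connecting Γ hS i).app C) :=
  (limDelta Γ R).exact₃ (shortExact_systemSequence hS C) i

end Exact

/-- A contravariant functor whose inverse systems have vanishing higher derived limits. -/
def IsLimAcyclic (X : ComplexFunctor R) : Prop :=
  ∀ (i : ℕ) (C : (Γ ⥤ CochainComplex (ModuleCat.{u} R) ℤ)ᵒᵖ)
    (x : (derivedTerm Γ (i + 1) X).obj C), x = 0

variable {Γ}

lemma isLimAcyclic_of_shortExact {S : ShortComplex (ComplexFunctor R)} (hS : S.ShortExact)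
    (h₁ : IsLimAcyclic Γ S.X₁) (h₃ : IsLimAcyclic Γ S.X₃) : IsLimAcyclic Γ S.X₂ := by
  intro i C x
  obtain ⟨y, rfl⟩ := (exact_derivedMap_derivedMap Γ hS (i + 1) C x).1 (h₃ i C _)
  rw [h₁ i C y]
  exact map_zero ((derivedMap Γ (i + 1) S.f).app C).hom

lemma bijective_derivedMap {S : ShortComplex (ComplexFunctor R)} (hS : S.ShortExact)
    (h₁ : IsLimAcyclic Γ S.X₁) (i : ℕ) (C : (Γ ⥤ CochainComplex (ModuleCat.{u} R) ℤ)ᵒᵖ) :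
    Function.Bijective ((derivedMap Γ (i + 1) S.g).app C) := by
  constructor
  · refine (injective_iff_map_eq_zero ((derivedMap Γ (i + 1) S.g).app C).hom).2 fun x hx => ?_
    obtain ⟨y, rfl⟩ := (exact_derivedMap_derivedMap Γ hS (i + 1) C x).1 hx
    rw [h₁ i C y]
    exact map_zero ((derivedMap Γ (i + 1) S.f).app C).hom
  · intro x
    exact (exact_derivedMap_connecting Γ hS (i + 1) C x).1 (h₁ (i + 1) C _)

lemma surjective_connecting {S : ShortComplex (ComplexFunctor R)} (hS : S.ShortExact)
    (h₂ : IsLimAcyclic Γ S.X₂) (i : ℕ) (C : (Γ ⥤ CochainComplex (ModuleCat.{u} R) ℤ)ᵒᵖ) :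
    Function.Surjective ((connecting Γ hS i).app C) := fun x =>
  (exact_connecting_derivedMap Γ hS i C x).1 (h₂ i C _)

/-- The kernel is the image of a derived limit of the middle term, which vanishes only in positive
degree. In degree zero the connecting map is just surjective. -/
lemma injective_connecting {S : ShortComplex (ComplexFunctor R)} (hS : S.ShortExact)
    (h₂ : IsLimAcyclic Γ S.X₂) (i : ℕ) (C : (Γ ⥤ CochainComplex (ModuleCat.{u} R) ℤ)ᵒᵖ) :
    Function.Injective ((connecting Γ hS (i + 1)).app C) := by
  refine (injective_iff_map_eq_zero ((connecting Γ hS (i + 1)).app C).hom).2 fun x hx => ?_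
  obtain ⟨y, rfl⟩ := (exact_derivedMap_connecting Γ hS (i + 1) C x).1 hx
  rw [h₂ i C y]
  exact map_zero ((derivedMap Γ (i + 1) S.g).app C).hom

variable [IsDirectedOrder Γ] [Nonempty Γ]

lemma isLimAcyclic_homFunctor (A : CochainComplex (ModuleCat.{u} R) ℤ ⥤ ModuleCat.{u} R)
    (I : ModuleCat.{u} R) (hI : Injective I) : IsLimAcyclic Γ (A.op ⋙ homFunctor I) := by
  intro i C x
  have := subsingleton_limFamily_homSystem (C.unop ⋙ A) I hI i
  exact Subsingleton.elim (α := (limFamily Γ R (i + 1)).obj (homSystem (C.unop ⋙ A) I)) x 0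

variable {G' G'' : ModuleCat.{u} R} (hG' : Injective G') (hG'' : Injective G'')

include hG' hG''

lemma isLimAcyclic_chainFunctor (n : ℤ) : IsLimAcyclic Γ (chainFunctor G' G'' n) := by
  have h₁ := isLimAcyclic_homFunctor (Γ := Γ)
    (HomologicalComplex.eval (ModuleCat.{u} R) (ComplexShape.up ℤ) (n + 1)) G'' hG''
  have h₃ := isLimAcyclic_homFunctor (Γ := Γ)
    (HomologicalComplex.eval (ModuleCat.{u} R) (ComplexShape.up ℤ) n) G' hG'
  have h₂ := isLimAcyclic_of_shortExact (shortExact_chainSequence (G' := G') (G'' := G'') n) h₁ h₃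
  exact h₂

lemma isLimAcyclic_vanishingSub (β : G' ⟶ G'') (n : ℤ) :
    IsLimAcyclic Γ (vanishingSub β n).functor := by
  have h₁ := isLimAcyclic_homFunctor (Γ := Γ) (coboundaryQuotient R n) G'' hG''
  have h₃ := isLimAcyclic_homFunctor (Γ := Γ) (cocycleQuotient R n) G' hG'
  have h₂ := isLimAcyclic_of_shortExact (shortExact_vanishingComponents β hG'' n) h₁ h₃
  exact h₂

end Systems

end ConeHomology

namespace CategoryTheory

/-- The descended maps are determined by their values on the images of `g`, so choosing them
objectwise already gives a natural transformation. -/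
lemma exists_desc_of_surjective {R : Type u} [CommRing R] {J : Type*} [Category* J]
    {X Y Z : J ⥤ ModuleCat.{u} R} (g : X ⟶ Y) (v : X ⟶ Z)
    (hg : ∀ j, Function.Surjective (g.app j))
    (h : ∀ j x, g.app j x = 0 → v.app j x = 0) :
    ∃ q : Y ⟶ Z, ∀ j x, q.app j (g.app j x) = v.app j x := by
  have key (j : J) : ∃ q : Y.obj j →ₗ[R] Z.obj j, ∀ x, q (g.app j x) = v.app j x := by
    refine ⟨(LinearMap.ker (g.app j).hom).liftQ (v.app j).hom (fun x hx => h j x hx) ∘ₗ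
      ((g.app j).hom.quotKerEquivOfSurjective (hg j)).symm.toLinearMap, fun x => ?_⟩
    have : ((g.app j).hom.quotKerEquivOfSurjective (hg j)).symm ((g.app j).hom x) =
        Submodule.Quotient.mk x := by
      rw [LinearEquiv.symm_apply_eq]
      rfl
    exact congrArg ((LinearMap.ker (g.app j).hom).liftQ (v.app j).hom
      (fun x hx => h j x hx)) this
  choose q hq using key
  refine ⟨{ app j := ModuleCat.ofHom (q j), naturality j j' f := ?_ }, hq⟩
  ext y
  obtain ⟨x, rfl⟩ := hg j y
  have h₁ : Y.map f (g.app j x) = g.app j' (X.map f x) :=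
    (congrArg (fun k => k.hom x) (g.naturality f)).symm
  have h₂ : Z.map f (v.app j x) = v.app j' (X.map f x) :=
    (congrArg (fun k => k.hom x) (v.naturality f)).symm
  change q j' (Y.map f (g.app j x)) = Z.map f (q j (g.app j x))
  rw [h₁, hq, hq, h₂]

end CategoryTheory

namespace ConeHomology

/-! ### Values on the colimit compared with limits of values -/

section Compare

variable (Γ : Type u) [Preorder Γ] {R : Type u} [CommRing R]

/-- The value of a contravariant functor on the colimit of a direct system. -/
noncomputable abbrev colimTerm (X : ComplexFunctor R) :
    (Γ ⥤ CochainComplex (ModuleCat.{u} R) ℤ)ᵒᵖ ⥤ ModuleCat.{u} R :=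
  (colim : (Γ ⥤ CochainComplex (ModuleCat.{u} R) ℤ) ⥤ _).op ⋙ X

/-- The cone with vertex the value on the colimit. -/
noncomputable def comparisonCone (X : ComplexFunctor R)
    (C : (Γ ⥤ CochainComplex (ModuleCat.{u} R) ℤ)ᵒᵖ) : Cone ((systemFunctor Γ X).obj C) where
  pt := (colimTerm Γ X).obj C
  π :=
    { app := fun γ => X.map (colimit.ι C.unop γ.unop).op
      naturality := fun γ γ' f => by
        change 𝟙 _ ≫ X.map (colimit.ι C.unop γ'.unop).op =
          X.map (colimit.ι C.unop γ.unop).op ≫ X.map (C.unop.map f.unop).op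
        rw [Category.id_comp, ← Functor.map_comp, ← op_comp, colimit.w] }

/-- A component of an element of the inverse limit. -/
noncomputable def component {X : ComplexFunctor R}
    {C : (Γ ⥤ CochainComplex (ModuleCat.{u} R) ℤ)ᵒᵖ} (γ : Γ) :
    (derivedTerm Γ 0 X).obj C ⟶ X.obj (Opposite.op (C.unop.obj γ)) :=
  limit.π ((systemFunctor Γ X).obj C) (Opposite.op γ)

/-- The canonical map from the value on the colimit to the limit of the values. -/
noncomputable def comparison (X : ComplexFunctor R) : colimTerm Γ X ⟶ derivedTerm Γ 0 X where
  app C := limit.lift ((systemFunctor Γ X).obj C) (comparisonCone Γ X C)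
  naturality C C' f := by
    apply limit.hom_ext
    intro γ
    have h : X.map (colim.map f.unop).op ≫ X.map (colimit.ι C'.unop γ.unop).op =
        X.map (colimit.ι C.unop γ.unop).op ≫ X.map (f.unop.app γ.unop).op := by
      rw [← Functor.map_comp, ← Functor.map_comp, ← op_comp, ← op_comp]
      simp
    have h₁ := limit.lift_π (comparisonCone Γ X C') γ
    have h₂ := limit.lift_π (comparisonCone Γ X C) γ
    have h₃ := limMap_π ((systemFunctor Γ X).map f) γ
    refine (Category.assoc _ _ _).trans ((congrArg (fun x => _ ≫ x) h₁).trans (h.trans ?_))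
    refine Eq.trans ?_ (Category.assoc _ _ _).symm
    refine Eq.trans ?_ (congrArg (fun x => _ ≫ x) h₃).symm
    refine Eq.trans ?_ (Category.assoc _ _ _)
    exact (congrArg (fun x => x ≫ ((systemFunctor Γ X).map f).app γ) h₂).symm

variable {G' G'' : ModuleCat.{u} R} (β : G' ⟶ G'')

variable {Γ}

lemma ext_component {X : ComplexFunctor R} {C : (Γ ⥤ CochainComplex (ModuleCat.{u} R) ℤ)ᵒᵖ}
    {x y : (derivedTerm Γ 0 X).obj C} (h : ∀ γ, component Γ γ x = component Γ γ y) : x = y :=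
  Concrete.limit_ext ((systemFunctor Γ X).obj C) x y fun γ => h γ.unop

lemma component_comparison {X : ComplexFunctor R}
    {C : (Γ ⥤ CochainComplex (ModuleCat.{u} R) ℤ)ᵒᵖ} (x : (colimTerm Γ X).obj C) (γ : Γ) :
    component Γ γ ((comparison Γ X).app C x) = X.map (colimit.ι C.unop γ).op x :=
  congrArg (fun k => k.hom x) (limit.lift_π (comparisonCone Γ X C) (Opposite.op γ))

lemma component_derivedMap {X Y : ComplexFunctor R} (f : X ⟶ Y)
    {C : (Γ ⥤ CochainComplex (ModuleCat.{u} R) ℤ)ᵒᵖ} (x : (derivedTerm Γ 0 X).obj C) (γ : Γ) :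
    component Γ γ ((derivedMap Γ 0 f).app C x) =
      f.app (Opposite.op (C.unop.obj γ)) (component Γ γ x) :=
  congrArg (fun k => k.hom x) (limMap_π (Functor.whiskerLeft C.unop.op f) (Opposite.op γ))

lemma map_component {X : ComplexFunctor R}
    {C : (Γ ⥤ CochainComplex (ModuleCat.{u} R) ℤ)ᵒᵖ} (x : (derivedTerm Γ 0 X).obj C)
    {γ γ' : Γ} (f : γ ⟶ γ') :
    X.map (C.unop.map f).op (component Γ γ' x) = component Γ γ x :=
  congrArg (fun k => k.hom x) (limit.w ((systemFunctor Γ X).obj C) f.op)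

lemma comparison_naturality {X Y : ComplexFunctor R} (f : X ⟶ Y)
    {C : (Γ ⥤ CochainComplex (ModuleCat.{u} R) ℤ)ᵒᵖ} (x : (colimTerm Γ X).obj C) :
    (derivedMap Γ 0 f).app C ((comparison Γ X).app C x) =
      (comparison Γ Y).app C (f.app (Opposite.op (colimit C.unop)) x) := by
  refine ext_component fun γ => ?_
  rw [component_derivedMap, component_comparison]
  refine Eq.trans ?_ (component_comparison (X := Y) _ γ).symm
  exact congrArg (fun k => k.hom x) (f.naturality (colimit.ι C.unop γ).op)

lemma colimit_linearMap_ext (C : Γ ⥤ CochainComplex (ModuleCat.{u} R) ℤ) (n : ℤ)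
    {M : Type u} [AddCommGroup M] [Module R M] {f g : (colimit C).X n →ₗ[R] M}
    (h : ∀ γ x, f (((colimit.ι C γ).f n).hom x) = g (((colimit.ι C γ).f n).hom x)) : f = g := by
  have := (isColimitOfPreserves (HomologicalComplex.eval (ModuleCat.{u} R) (ComplexShape.up ℤ) n)
    (colimit.isColimit C)).hom_ext (W := ModuleCat.of R M) (f := ModuleCat.ofHom f)
      (f' := ModuleCat.ofHom g) (fun γ => by
        ext x
        exact h γ x)
  exact congrArg ModuleCat.Hom.hom this

lemma exists_colimit_linearMap (C : Γ ⥤ CochainComplex (ModuleCat.{u} R) ℤ) (n : ℤ)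
    {M : Type u} [AddCommGroup M] [Module R M] (f : ∀ γ, (C.obj γ).X n →ₗ[R] M)
    (hf : ∀ {γ γ' : Γ} (a : γ ⟶ γ') x, f γ' (((C.map a).f n).hom x) = f γ x) :
    ∃ g : (colimit C).X n →ₗ[R] M, ∀ γ x, g (((colimit.ι C γ).f n).hom x) = f γ x := by
  let e := HomologicalComplex.eval (ModuleCat.{u} R) (ComplexShape.up ℤ) n
  let t : Cocone (C ⋙ e) :=
    { pt := ModuleCat.of R M
      ι :=
        { app γ := ModuleCat.ofHom (f γ)
          naturality γ γ' a := by
            ext x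
            exact hf a x } }
  let hc := isColimitOfPreserves e (colimit.isColimit C)
  exact ⟨(hc.desc t).hom, fun γ x => congrArg (fun k => k.hom x) (hc.fac t γ)⟩

/-- Colimits of complexes are computed degreewise, so a compatible family of pairs of linear maps
glues to a pair on the colimit. -/
lemma comparison_chain_surjective (n : ℤ)
    (C : (Γ ⥤ CochainComplex (ModuleCat.{u} R) ℤ)ᵒᵖ) :
    Function.Surjective ((comparison Γ (chainFunctor G' G'' n)).app C) := by
  intro x
  let y (γ : Γ) : Chain G' G'' n (C.unop.obj γ) := component Γ γ x
  have hy {γ γ' : Γ} (a : γ ⟶ γ') : coneMapDeg G' G'' (C.unop.map a) n (y γ') = y γ :=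
    map_component x a
  obtain ⟨g₁, h₁⟩ := exists_colimit_linearMap C.unop n (fun γ => (y γ).1)
    (fun a x => congrArg (fun k => k.1 x) (hy a))
  obtain ⟨g₂, h₂⟩ := exists_colimit_linearMap C.unop (n + 1) (fun γ => (y γ).2)
    (fun a x => congrArg (fun k => k.2 x) (hy a))
  refine ⟨((g₁, g₂) : Chain G' G'' n (colimit C.unop)), ext_component fun γ => ?_⟩
  refine (component_comparison (X := chainFunctor G' G'' n) _ γ).trans ?_
  exact Prod.ext (LinearMap.ext (h₁ γ)) (LinearMap.ext (h₂ γ))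

/-- Chains glue uniquely, and the cycle conditions are equalities of linear maps out of the cochain
modules of the colimit, which can be tested on each C_γ. -/
lemma comparison_cycle_bijective (n : ℤ)
    (C : (Γ ⥤ CochainComplex (ModuleCat.{u} R) ℤ)ᵒᵖ) :
    Function.Bijective ((comparison Γ (cycleSub β n).functor).app C) := by
  constructor
  · intro (x : (cycleSub β n).carrier (colimit C.unop))
      (y : (cycleSub β n).carrier (colimit C.unop)) h
    have hγ (γ : Γ) : coneMapDeg G' G'' (colimit.ι C.unop γ) n x.1 =
        coneMapDeg G' G'' (colimit.ι C.unop γ) n y.1 :=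
      congrArg Subtype.val ((component_comparison (X := (cycleSub β n).functor) x γ).symm.trans
        ((congrArg (component Γ γ) h).trans
          (component_comparison (X := (cycleSub β n).functor) y γ)))
    refine Subtype.ext (Prod.ext ?_ ?_)
    · exact colimit_linearMap_ext C.unop n fun γ x => congrArg (fun k => k.1 x) (hγ γ)
    · exact colimit_linearMap_ext C.unop (n + 1) fun γ x => congrArg (fun k => k.2 x) (hγ γ)
  · intro x
    obtain ⟨y, hy⟩ := comparison_chain_surjective n C ((derivedMap Γ 0 (cycleSub β n).ι).app C x)
    change Chain G' G'' n (colimit C.unop) at y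
    have hγ (γ : Γ) : coneMapDeg G' G'' (colimit.ι C.unop γ) n y =
        (component Γ γ x : (cycleSub β n).carrier (C.unop.obj γ)).1 :=
      (component_comparison (X := chainFunctor G' G'' n) y γ).symm.trans
        ((congrArg (component Γ γ) hy).trans (component_derivedMap (cycleSub β n).ι x γ))
    have mem : y ∈ (cycleSub β n).carrier (colimit C.unop) := by
      have hx (γ : Γ) : coneMapDeg G' G'' (colimit.ι C.unop γ) n y ∈
          (cycleSub β n).carrier (C.unop.obj γ) := by
        rw [hγ γ]
        exact (component Γ γ x : (cycleSub β n).carrier (C.unop.obj γ)).2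
      constructor
      · intro j
        refine fun z => congrArg (fun k => k z) (colimit_linearMap_ext C.unop j
          (f := y.1 ∘ₗ ((colimit C.unop).d j n).hom) (g := 0) fun γ z => ?_)
        exact (congrArg y.1 (hom_comm_apply (colimit.ι C.unop γ) j n z)).trans ((hx γ).1 j z)
      · refine fun z => congrArg (fun k => k z) (colimit_linearMap_ext C.unop n
          (f := β.hom ∘ₗ y.1) (g := y.2 ∘ₗ ((colimit C.unop).d n (n + 1)).hom) fun γ z => ?_)
        exact ((hx γ).2 z).trans
          (congrArg y.2 (hom_comm_apply (colimit.ι C.unop γ) n (n + 1) z)).symm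
    refine ⟨(⟨y, mem⟩ : (cycleSub β n).carrier (colimit C.unop)), ext_component fun γ => ?_⟩
    refine (component_comparison (X := (cycleSub β n).functor) _ γ).trans ?_
    exact Subtype.ext (hγ γ)

end Compare

end ConeHomology

namespace ConeHomology

/-! ### Splitting of the derived limits of homology, and the kernel and image of the canonical map
-/

section LongExactSequence

variable {Γ : Type u} [Preorder Γ] [IsDirectedOrder Γ] [Nonempty Γ] {R : Type u} [CommRing R]
  {G' G'' : ModuleCat.{u} R} (β : G' ⟶ G'') (hG' : Injective G') (hG'' : Injective G'')

include hG' hG''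

/-- The composite Z_n → H_n → Z_n/L_n is an isomorphism on positive derived limits, since L_n is
acyclic. The retraction is the map induced by H_n → Z_n/L_n followed by the inverse of this
isomorphism. -/
lemma exists_retraction (i : ℕ) (n : ℤ) :
    ∃ r : derivedTerm Γ (i + 1) (barHomology β n) ⟶
        derivedTerm Γ (i + 1) (cycleSub β n).functor,
      ∀ C x, r.app C ((derivedMap Γ (i + 1) (toHomology β n)).app C x) = x := by
  obtain ⟨q, hq⟩ := exists_factorization β n
  have hL : IsLimAcyclic Γ (vanishingSequence β n).X₁ := isLimAcyclic_vanishingSub hG' hG'' β n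
  have bij := bijective_derivedMap (shortExact_vanishingSequence β n) hL i
  let m : derivedTerm Γ (i + 1) (cycleSub β n).functor ⟶
      derivedTerm Γ (i + 1) (vanishingSequence β n).X₃ :=
    derivedMap Γ (i + 1) (vanishingSequence β n).g
  have isIso_app (C) : IsIso (m.app C) := (ConcreteCategory.isIso_iff_bijective (m.app C)).2 (bij C)
  have : IsIso m := NatIso.isIso_of_isIso_app m
  have h : derivedMap Γ (i + 1) (toHomology β n) ≫ derivedMap Γ (i + 1) q ≫ inv m = 𝟙 _ := by
    rw [← Category.assoc, ← derivedMap_comp, hq]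
    exact IsIso.hom_inv_id m
  exact ⟨derivedMap Γ (i + 1) q ≫ inv m, fun C x => congrArg (fun k => (k.app C).hom x) h⟩

lemma injective_derivedMap_toHomology (i : ℕ) (n : ℤ)
    (C : (Γ ⥤ CochainComplex (ModuleCat.{u} R) ℤ)ᵒᵖ) :
    Function.Injective ((derivedMap Γ (i + 1) (toHomology β n)).app C) := by
  obtain ⟨r, hr⟩ := exists_retraction (Γ := Γ) β hG' hG'' i n
  exact Function.LeftInverse.injective (hr C)

/-- The map is the composite of the connecting maps lim^(i) H_n → lim^(i+1) B_n → lim^(i+2) Z_{n+1}.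
The second is bijective because K_{n+1} is acyclic. The first is onto because lim^(i+1) Z_n →
lim^(i+1) H_n is injective, so that lim^(i+1) B_n → lim^(i+1) Z_n is zero. The case i = 0 is
included. -/
lemma exists_differential (i : ℕ) (n : ℤ) :
    ∃ k : derivedTerm Γ i (barHomology β n) ⟶
        derivedTerm Γ (i + 2) (cycleSub β (n + 1)).functor,
      ∀ C, Function.Surjective (k.app C) ∧
        Function.Exact ((derivedMap Γ i (toHomology β n)).app C) (k.app C) := by
  have hS := shortExact_homologySequence β n
  have hS' := shortExact_boundarySequence β n
  have hK : IsLimAcyclic Γ (boundarySequence β n).X₂ := isLimAcyclic_chainFunctor hG' hG'' (n + 1)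
  let k₁ := connecting Γ hS i
  let k₂ := connecting Γ hS' (i + 1)
  refine ⟨k₁ ≫ k₂, fun C => ⟨?_, ?_⟩⟩
  · intro z
    obtain ⟨y, rfl⟩ := surjective_connecting hS' hK (i + 1) C z
    have hy : (derivedMap Γ (i + 1) (homologySequence β n).f).app C y = 0 := by
      apply injective_derivedMap_toHomology β hG' hG'' i n C
      refine ((exact_derivedMap_derivedMap Γ hS (i + 1) C _).2 ⟨y, rfl⟩).trans ?_
      exact (map_zero ((derivedMap Γ (i + 1) (toHomology β n)).app C).hom).symm
    obtain ⟨x, rfl⟩ := (exact_connecting_derivedMap Γ hS i C y).1 hy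
    exact ⟨x, rfl⟩
  · intro x
    refine Iff.trans ?_ (exact_derivedMap_connecting Γ hS i C x)
    constructor
    · intro hx
      apply injective_connecting hS' hK i C
      exact hx.trans (map_zero (k₂.app C).hom).symm
    · intro hx
      exact (congrArg (k₂.app C).hom hx).trans (map_zero (k₂.app C).hom)

omit [IsDirectedOrder Γ] [Nonempty Γ] hG' hG'' in
-- A retraction of the inclusion splits the sequence. The projection x ↦ x - j (r x) onto the kernel
-- of r vanishes on the image of j and hence descends along k; naturality is inherited from j, k and
-- r.
lemma exists_section {A B D : (Γ ⥤ CochainComplex (ModuleCat.{u} R) ℤ)ᵒᵖ ⥤ ModuleCat.{u} R}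
    {j : A ⟶ B} {k : B ⟶ D} {r : B ⟶ A} (hr : ∀ C x, r.app C (j.app C x) = x)
    (hk : ∀ C, Function.Surjective (k.app C)) (hjk : ∀ C, Function.Exact (j.app C) (k.app C)) :
    ∃ t : D ⟶ B, ∀ C, Function.Injective (t.app C) ∧ Function.Exact (t.app C) (r.app C) := by
  obtain ⟨t, ht⟩ := CategoryTheory.exists_desc_of_surjective k (𝟙 B - r ≫ j) hk (by
    intro C x hx
    obtain ⟨y, rfl⟩ := (hjk C x).1 hx
    change j.app C y - j.app C (r.app C (j.app C y)) = 0
    rw [hr, sub_self])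
  have ht' (C) (x : B.obj C) : t.app C (k.app C x) = x - j.app C (r.app C x) := ht C x
  refine ⟨t, fun C => ⟨(injective_iff_map_eq_zero (t.app C).hom).2 fun y hy => ?_, fun x => ?_⟩⟩
  · obtain ⟨x, rfl⟩ := hk C y
    have : x = j.app C (r.app C x) := sub_eq_zero.1 ((ht' C x).symm.trans hy)
    exact (hjk C x).2 ⟨_, this.symm⟩
  · constructor
    · intro hx
      refine ⟨k.app C x, (ht' C x).trans ?_⟩
      rw [hx]
      exact (congrArg (fun y => x - y) (map_zero (j.app C).hom)).trans (sub_zero x)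
    · rintro ⟨y, rfl⟩
      obtain ⟨x, rfl⟩ := hk C y
      rw [ht']
      refine (map_sub (r.app C).hom _ _).trans (sub_eq_zero.2 ?_)
      exact (hr C (r.app C x)).symm

omit [IsDirectedOrder Γ] [Nonempty Γ] hG' hG'' in
-- Both Z_n → H_n evaluated at the colimit and the comparison for Z_n are surjective, so in the
-- naturality square either route from the cycles of the colimit has the same image in lim H_n.
lemma range_canonicalMap (n : ℤ) (C : (Γ ⥤ CochainComplex (ModuleCat.{u} R) ℤ)ᵒᵖ)
    (x : (derivedTerm Γ 0 (barHomology β n)).obj C) :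
    x ∈ Set.range ((comparison Γ (barHomology β n)).app C) ↔
      x ∈ Set.range ((derivedMap Γ 0 (toHomology β n)).app C) := by
  constructor
  · rintro ⟨y, rfl⟩
    obtain ⟨z, rfl⟩ := toHomology_surjective β n (Opposite.op (colimit C.unop)) y
    exact ⟨(comparison Γ (cycleSub β n).functor).app C z, comparison_naturality (toHomology β n) z⟩
  · rintro ⟨z, rfl⟩
    obtain ⟨y, rfl⟩ := (comparison_cycle_bijective β n C).2 z
    exact ⟨_, (comparison_naturality (toHomology β n) y).symm⟩

omit [IsDirectedOrder Γ] [Nonempty Γ] hG' hG'' in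
lemma injective_derivedMap_zero {S : ShortComplex (ComplexFunctor R)} (hS : S.ShortExact)
    (C : (Γ ⥤ CochainComplex (ModuleCat.{u} R) ℤ)ᵒᵖ) :
    Function.Injective ((derivedMap Γ 0 S.f).app C) := by
  intro x y h
  refine ext_component fun γ => hS.app_injective _ ?_
  rw [← component_derivedMap, ← component_derivedMap, h]

/-- As K_{n+1} is acyclic, lim^(1) Z_{n+1} is the cokernel of lim K_{n+1} → lim B_n. Chains on the
colimit map onto lim K_{n+1}, so the image here consists of the boundaries of the colimit. Inside
lim Z_n, which is the module of cycles of the colimit, lim B_n consists of the cycles whose class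
dies in lim H_n. The cokernel is thus the kernel of the canonical map. -/
lemma exists_fromCycles (n : ℤ) :
    ∃ v : derivedTerm Γ 1 (cycleSub β (n + 1)).functor ⟶ colimTerm Γ (barHomology β n),
      ∀ C, Function.Injective (v.app C) ∧
        Function.Exact (v.app C) ((comparison Γ (barHomology β n)).app C) := by
  have hS := shortExact_homologySequence β n
  have hS' := shortExact_boundarySequence β n
  have hK : IsLimAcyclic Γ (boundarySequence β n).X₂ := isLimAcyclic_chainFunctor hG' hG'' (n + 1)
  let κ := comparison Γ (cycleSub β n).functor
  have isIso_app (C) : IsIso (κ.app C) := (ConcreteCategory.isIso_iff_bijective (κ.app C)).2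
    (comparison_cycle_bijective β n C)
  have : IsIso κ := NatIso.isIso_of_isIso_app κ
  let p : colimTerm Γ (cycleSub β n).functor ⟶ colimTerm Γ (barHomology β n) :=
    Functor.whiskerLeft _ (toHomology β n)
  let κ' : derivedTerm Γ 0 (cycleSub β n).functor ⟶ colimTerm Γ (cycleSub β n).functor := inv κ
  -- A compatible family of boundaries is glued to a cycle of the colimit, and its homology class is
  -- taken.
  let w : derivedTerm Γ 0 (boundarySub β n).functor ⟶ colimTerm Γ (barHomology β n) :=
    derivedMap Γ 0 (homologySequence β n).f ≫ κ' ≫ p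
  have hκ (C) (x) : κ.app C (κ'.app C x) = x :=
    congrArg (fun k => (k.app C).hom x) (IsIso.inv_hom_id κ)
  have hκ' (C) (x) : κ'.app C (κ.app C x) = x :=
    congrArg (fun k => (k.app C).hom x) (IsIso.hom_inv_id κ)
  -- the values of `w` at elements which come from the boundaries of the colimit
  have hw (C : (Γ ⥤ CochainComplex (ModuleCat.{u} R) ℤ)ᵒᵖ)
      (x : (boundarySub β n).functor.obj (Opposite.op (colimit C.unop))) :
      w.app C ((comparison Γ (boundarySub β n).functor).app C x) = 0 := by
    change p.app C (κ'.app C ((derivedMap Γ 0 (homologySequence β n).f).app C _)) = 0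
    refine (congrArg (fun y => p.app C (κ'.app C y))
      (comparison_naturality (homologySequence β n).f x)).trans ?_
    refine (congrArg (p.app C) (hκ' C _)).trans ?_
    exact (hS.app_exact (Opposite.op (colimit C.unop)) _).2 ⟨x, rfl⟩
  -- The kernel of the connecting map comes from lim K_{n+1}, hence from chains on the colimit; on
  -- their boundaries `w` is zero.
  obtain ⟨v, hv⟩ := CategoryTheory.exists_desc_of_surjective (connecting Γ hS' 0) w
    (surjective_connecting hS' hK 0) (by
      intro C x hx
      obtain ⟨y, rfl⟩ := (exact_derivedMap_connecting Γ hS' 0 C x).1 hx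
      obtain ⟨z, rfl⟩ := comparison_chain_surjective (n + 1) C y
      refine (congrArg (w.app C) (comparison_naturality (toBoundary β n) z)).trans ?_
      exact hw C _)
  have key (C) (x : (derivedTerm Γ 0 (boundarySub β n).functor).obj C) :
      (comparison Γ (barHomology β n)).app C (w.app C x) = 0 := by
    have h := comparison_naturality (toHomology β n)
      (κ'.app C ((derivedMap Γ 0 (homologySequence β n).f).app C x))
    refine h.symm.trans ?_
    refine (congrArg ((derivedMap Γ 0 (toHomology β n)).app C) (hκ C _)).trans ?_
    exact (exact_derivedMap_derivedMap Γ hS 0 C _).2 ⟨x, rfl⟩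
  refine ⟨v, fun C => ⟨(injective_iff_map_eq_zero (v.app C).hom).2 fun y hy => ?_, fun x => ?_⟩⟩
  · obtain ⟨x, rfl⟩ := surjective_connecting hS' hK 0 C y
    have hx : w.app C x = 0 := (hv C x).symm.trans hy
    obtain ⟨b, hb⟩ := (hS.app_exact (Opposite.op (colimit C.unop)) _).1 hx
    have hb' : (comparison Γ (boundarySub β n).functor).app C b = x := by
      apply injective_derivedMap_zero hS C
      refine (comparison_naturality (homologySequence β n).f b).trans ?_
      refine (congrArg (κ.app C) hb).trans ?_
      exact hκ C _
    -- An element killed by `w` is a boundary of the colimit. A chain `c` bounding it gives an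
    -- element of lim K_{n+1}, so the connecting map kills it.
    obtain ⟨c, rfl⟩ := (shortExact_boundarySequence β n).app_surjective
      (Opposite.op (colimit C.unop)) b
    rw [← hb']
    refine (exact_derivedMap_connecting Γ hS' 0 C _).2 ⟨(comparison Γ _).app C c, ?_⟩
    exact comparison_naturality (toBoundary β n) c
  · constructor
    · intro hx
      obtain ⟨z, rfl⟩ := toHomology_surjective β n (Opposite.op (colimit C.unop)) x
      have h := (comparison_naturality (toHomology β n) z).trans hx
      obtain ⟨b, hb⟩ := (exact_derivedMap_derivedMap Γ hS 0 C _).1 h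
      refine ⟨(connecting Γ hS' 0).app C b, (hv C b).trans ?_⟩
      refine congrArg (p.app C) ((congrArg (κ'.app C) hb).trans ?_)
      exact hκ' C z
    · rintro ⟨y, rfl⟩
      obtain ⟨b, rfl⟩ := surjective_connecting hS' hK 0 C y
      exact (congrArg ((comparison Γ (barHomology β n)).app C) (hv C b)).trans (key C b)

end LongExactSequence

end ConeHomology

namespace ConeHomology

/-! ### Assembling the pieces into one sequence -/

section Splicing

variable {Γ : Type u} [Preorder Γ] [IsDirectedOrder Γ] [Nonempty Γ] {R : Type u} [CommRing R]
  {G' G'' : ModuleCat.{u} R} (β : G' ⟶ G'') (hG' : Injective G') (hG'' : Injective G'')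

/-- A chosen retraction of the map from the derived limits of the cycles to those of the
homology. -/
noncomputable def retraction (i : ℕ) (n : ℤ) :
    derivedTerm Γ (i + 1) (barHomology β n) ⟶ derivedTerm Γ (i + 1) (cycleSub β n).functor :=
  (exists_retraction β hG' hG'' i n).choose

lemma retraction_derivedMap (i : ℕ) (n : ℤ) (C : (Γ ⥤ CochainComplex (ModuleCat.{u} R) ℤ)ᵒᵖ)
    (x : (derivedTerm Γ (i + 1) (cycleSub β n).functor).obj C) :
    (retraction β hG' hG'' i n).app C ((derivedMap Γ (i + 1) (toHomology β n)).app C x) = x :=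
  (exists_retraction β hG' hG'' i n).choose_spec C x

lemma surjective_retraction (i : ℕ) (n : ℤ)
    (C : (Γ ⥤ CochainComplex (ModuleCat.{u} R) ℤ)ᵒᵖ) :
    Function.Surjective ((retraction (Γ := Γ) β hG' hG'' i n).app C) := fun x =>
  ⟨_, retraction_derivedMap β hG' hG'' i n C x⟩

include hG' hG'' in
-- Free target indices allow the spliced maps to have exactly the degrees of the terms of the
-- sequence, whose index expressions agree only up to arithmetic.
lemma exists_differential_of_eq {i i' : ℕ} {n n' : ℤ} (hi : i + 2 = i') (hn : n + 1 = n') :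
    ∃ k : derivedTerm Γ i (barHomology β n) ⟶ derivedTerm Γ i' (cycleSub β n').functor,
      ∀ C, Function.Surjective (k.app C) ∧
        Function.Exact ((derivedMap Γ i (toHomology β n)).app C) (k.app C) := by
  subst hi hn
  exact exists_differential β hG' hG'' i n

lemma exists_section_of_eq {i i' : ℕ} {n n' : ℤ} (hi : i + 3 = i') (hn : n + 1 = n') :
    ∃ t : derivedTerm Γ i' (cycleSub β n').functor ⟶ derivedTerm Γ (i + 1) (barHomology β n),
      ∀ C, Function.Injective (t.app C) ∧
        Function.Exact (t.app C) ((retraction β hG' hG'' i n).app C) := by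
  obtain ⟨k, hk⟩ := exists_differential_of_eq (Γ := Γ) (i := i + 1) (i' := i') β hG' hG'' hi hn
  exact exists_section (retraction_derivedMap β hG' hG'' i n) (fun C => (hk C).1)
    (fun C => (hk C).2)

include hG' hG'' in
lemma exists_fromCycles_of_eq {n n' : ℤ} (hn : n + 1 = n') :
    ∃ v : derivedTerm Γ 1 (cycleSub β n').functor ⟶ colimTerm Γ (barHomology β n),
      ∀ C, Function.Injective (v.app C) ∧
        Function.Exact (v.app C) ((comparison Γ (barHomology β n)).app C) := by
  subst hn
  exact exists_fromCycles β hG' hG'' n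

/-- Precomposing with a surjection does not change an image, and postcomposing with an injection
does not change a kernel. -/
lemma exact_comp {R : Type u} [CommRing R] {X Y Z W V : ModuleCat.{u} R} {r : X ⟶ Y} {t : Y ⟶ Z}
    {r' : Z ⟶ W} {t' : W ⟶ V} (hr : Function.Surjective r) (ht : Function.Exact t r')
    (ht' : Function.Injective t') : Function.Exact (r ≫ t) (r' ≫ t') := by
  intro x
  have h₁ : (r' ≫ t') x = 0 ↔ r' x = 0 :=
    ⟨fun h => ht' (h.trans (map_zero t'.hom).symm),
      fun h => (congrArg t'.hom h).trans (map_zero t'.hom)⟩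
  rw [h₁, ht x]
  constructor
  · rintro ⟨y, rfl⟩
    obtain ⟨z, rfl⟩ := hr y
    exact ⟨z, rfl⟩
  · rintro ⟨z, rfl⟩
    exact ⟨r z, rfl⟩

lemma exact_comp_left {R : Type u} [CommRing R] {X Y Z W : ModuleCat.{u} R} {r : X ⟶ Y}
    {t : Y ⟶ Z} {f : Z ⟶ W} (hr : Function.Surjective r) (ht : Function.Exact t f) :
    Function.Exact (r ≫ t) f := by
  have := exact_comp (t' := 𝟙 W) hr ht Function.injective_id
  rwa [Category.comp_id] at this

end Splicing

end ConeHomology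

theorem theorem4 (R : Type u) [CommRing R] [IsDomain R] [IsPrincipalIdealRing R]
    (G G' G'' : ModuleCat.{u} R) (α : G ⟶ G') (β : G' ⟶ G'') (w : α ≫ β = 0)
    (hres : (ShortComplex.mk α β w).ShortExact)
    (hG' : Injective G') (hG'' : Injective G'')
    (Γ : Type u) [Preorder Γ] [IsDirectedOrder Γ] [Nonempty Γ] (n : ℤ) :
    ∃ (a : ∀ k : ℕ, ConeHomology.oddTerm Γ β n (k + 1) ⟶ ConeHomology.oddTerm Γ β n k)
      (b : ConeHomology.oddTerm Γ β n 0 ⟶ ConeHomology.barColim Γ β n)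
      (c : ConeHomology.barLim Γ β n ⟶ ConeHomology.evenTerm Γ β n 0)
      (d : ∀ k : ℕ, ConeHomology.evenTerm Γ β n k ⟶ ConeHomology.evenTerm Γ β n (k + 1)),
      ∀ C : Γ ⥤ CochainComplex (ModuleCat.{u} R) ℤ,
        (∀ k : ℕ, Function.Exact ((a (k + 1)).app (Opposite.op C)) ((a k).app (Opposite.op C))) ∧
        Function.Exact ((a 0).app (Opposite.op C)) (b.app (Opposite.op C)) ∧
        Function.Exact (b.app (Opposite.op C))
          ((ConeHomology.canonicalMap Γ β n).app (Opposite.op C)) ∧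
        Function.Exact ((ConeHomology.canonicalMap Γ β n).app (Opposite.op C))
          (c.app (Opposite.op C)) ∧
        Function.Exact (c.app (Opposite.op C)) ((d 0).app (Opposite.op C)) ∧
        (∀ k : ℕ,
          Function.Exact ((d k).app (Opposite.op C)) ((d (k + 1)).app (Opposite.op C))) := by
  let r (k : ℕ) := ConeHomology.retraction (Γ := Γ) β hG' hG'' (2 * k) (n + k + 1)
  have hr (k : ℕ) (C) : Function.Surjective ((r k).app C) :=
    ConeHomology.surjective_retraction β hG' hG'' (2 * k) (n + k + 1) C
  -- Here `t k` embeds lim^(2k+3) Z_{n+k+2} in lim^(2k+1) H_{n+k+1} as the kernel of `r k`. The cast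
  -- `(k + 1 : ℕ)` reproduces the index of the next term.
  choose t ht using fun k : ℕ => ConeHomology.exists_section_of_eq (Γ := Γ) (i := 2 * k)
    (i' := 2 * (k + 1) + 1) (n := n + k + 1) (n' := n + (k + 1 : ℕ) + 1) β hG' hG''
    (by lia) (by push_cast; ring)
  obtain ⟨v, hv⟩ := ConeHomology.exists_fromCycles_of_eq (Γ := Γ) (n := n)
    (n' := n + (0 : ℕ) + 1) β hG' hG'' (by simp)
  let j (k : ℕ) := ConeHomology.derivedMap Γ (2 * k + 2) (ConeHomology.toHomology β (n + k + 1))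
  have hj (k : ℕ) (C) : Function.Injective ((j k).app C) :=
    ConeHomology.injective_derivedMap_toHomology β hG' hG'' (2 * k + 1) (n + k + 1) C
  obtain ⟨e, he⟩ := ConeHomology.exists_differential_of_eq (Γ := Γ) (i := 0) (i' := 2 * 0 + 2)
    (n := n) (n' := n + (0 : ℕ) + 1) β hG' hG'' rfl (by simp)
  choose d hd using fun k : ℕ => ConeHomology.exists_differential_of_eq (Γ := Γ) (i := 2 * k + 2)
    (i' := 2 * (k + 1) + 2) (n := n + k + 1) (n' := n + (k + 1 : ℕ) + 1) β hG' hG''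
    (by lia) (by push_cast; ring)
  -- Every map except the canonical one is a surjection onto a derived limit of cycles followed by
  -- an injection.
  refine ⟨fun k => r (k + 1) ≫ t k, r 0 ≫ v, e ≫ j 0, fun k => d k ≫ j (k + 1), fun C =>
    ⟨fun k => ?_, ?_, ?_, ?_, ?_, fun k => ?_⟩⟩
  · exact ConeHomology.exact_comp (hr (k + 1 + 1) (.op C)) (ht (k + 1) (.op C)).2
      (ht k (.op C)).1
  · exact ConeHomology.exact_comp (hr 1 (.op C)) (ht 0 (.op C)).2 (hv (.op C)).1
  · exact ConeHomology.exact_comp_left (hr 0 (.op C)) (hv (.op C)).2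
  -- Since `j 0` is injective, the kernel of `e ≫ j 0` is that of `e`, which is the image of lim Z_n
  -- and so the image of the canonical map.
  · intro x
    refine Iff.trans ?_ (ConeHomology.range_canonicalMap β n (.op C) x).symm
    refine Iff.trans ?_ ((he (.op C)).2 x)
    exact ⟨fun h => hj 0 (.op C) (h.trans (map_zero ((j 0).app (.op C)).hom).symm),
      fun h => (congrArg ((j 0).app (.op C)).hom h).trans (map_zero ((j 0).app (.op C)).hom)⟩
  · exact ConeHomology.exact_comp (he (.op C)).1 (hd 0 (.op C)).2 (hj 1 (.op C))
  · exact ConeHomology.exact_comp (hd k (.op C)).1 (hd (k + 1) (.op C)).2 (hj (k + 1 + 1) (.op C))
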